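/- Let $m \ge 0$ be an integer and let $a, b_1,\dots,b_m, c_1,\dots,c_m \in \mathbb{C}$ be arbitrary. Put $\theta_{x_i} = x_i \partial_{x_i}$, and let $$\ell_i^A = \theta_{x_i}(\theta_{x_i} + c_i - 1) - x_i(\theta_{x_1} + \cdots + \theta_{x_m} + a)(\theta_{x_i} + b_i) \qquad (i = 1,\dots,m)$$ be the operators annihilating Lauricella's series $F_A$. Let $D = \mathbb{C}[X_1,\dots,X_m]\langle \partial_{X_1},\dots,\partial_{X_m}\rangle$ be the Weyl algebra, $\theta_{X_i} = X_i\partial_{X_i}$, and $$p_i^A = X_i\,\theta_{X_i}(-\theta_{X_i} + c_i - 1) + (\theta_{X_1} + \cdots + \theta_{X_m} - a)(\theta_{X_i} - b_i) \in D \qquad (i = 1,\dots,m).$$ Every $P \in D$ has a unique expansion $P = \sum c_{\alpha\beta} X^\alpha \partial_X^\beta$; its terms are viewed as $c_{\alpha\beta} X^\alpha \xi^\beta \in \mathbb{C}[X,\xi]$ with commuting variables $\xi_1,\dots,\xi_m$. Given any term order $<'$ on the monomials $X^\alpha \xi^\beta$ as tie-breaker, let $<_{(\mathbf 0,\mathbf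 1)}$ be the term order that compares first $|\beta| = \beta_1+\cdots+\beta_m$, then $|\alpha| = \alpha_1+\cdots+\alpha_m$, and then uses $<'$. The initial term $\mathrm{in}_<(P)$ is the largest term of $P$ with its coefficient. A Gröbner basis of a left ideal $I \subseteq D$ is a finite set $G$ that generates $I$ as a left ideal and is such that $\{\mathrm{in}_<(g) : g \in G\}$ generates the ideal $\langle \mathrm{in}_<(P) : P \in I \rangle$ of $\mathbb{C}[X,\xi]$. The $(\mathbf 0,\mathbf 1)$-initial form of $P$ is the sum of the terms $c_{\alpha\beta}X^\alpha\xi^\beta$ of $P$ with $|\beta|$ maximal. Then: 1. Under the change of coordinates $X_i = 1/x_i$ on the torus $(\mathbb{C}^*)^m$, the operator $\ell_i^A$ becomes $-X_i^{-1} p_i^A$; that is, $p_i^A$ equals $-X_i$ times the transform of $\ell_i^A$, as operators on Laurent polynomials. 2. For every tie-breaking term order $<'$, the set $\{p_1^A,\dots,p_m^A\}$ is a Gröbner basis, with respect to $<_{(\mathbf 0,\mathbf 1)}$, of the left ideal $I_A(m)' = D\cdot\{p_1^A,\dots,p_m^A\}$. 3. For all $i$ and all parameters $a_1',\dots,a_m',b_1',\dots,b_m',c'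 \in \mathbb{C}$, the $(\mathbf 0,\mathbf 1)$-initial form of $p_i^A$ coincides with that of $$\ell_i^B = \theta_{X_i}(\theta_{X_1} + \cdots + \theta_{X_m} + c' - 1) - X_i(\theta_{X_i} + a_i')(\theta_{X_i} + b_i'),$$ the operator of Lauricella's $F_B$ written in the variables $X$. -/

import Mathlib

open scoped MonomialOrder

noncomputable section

namespace Lauricella

/-! ### The Weyl algebra -/

/-- Multiplication by the variable `x_i`, acting on `ℂ[x_1, …, x_m]`. -/
def mulX {m : ℕ} (i : Fin m) : Module.End ℂ (MvPolynomial (Fin m) ℂ) :=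
  LinearMap.mulLeft ℂ (MvPolynomial.X i)

/-- The partial derivative `∂_i`, acting on `ℂ[x_1, …, x_m]`. -/
def partialD {m : ℕ} (i : Fin m) : Module.End ℂ (MvPolynomial (Fin m) ℂ) :=
  (MvPolynomial.pderiv i : Derivation ℂ (MvPolynomial (Fin m) ℂ) (MvPolynomial (Fin m) ℂ))

/-- The Weyl algebra `D = ℂ[x_1, …, x_m]⟨∂_1, …, ∂_m⟩` of differential operators with polynomial
coefficients: the algebra of operators on polynomials generated by the `x_i` and the `∂_i`. -/
def WeylAlgebra (m : ℕ) : Subalgebra ℂ (Module.End ℂ (MvPolynomial (Fin m) ℂ)) :=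
  Algebra.adjoin ℂ (Set.range mulX ∪ Set.range partialD)

/-- The element `x_i` of `D`. -/
def x {m : ℕ} (i : Fin m) : WeylAlgebra m :=
  ⟨mulX i, Algebra.subset_adjoin (Or.inl ⟨i, rfl⟩)⟩

/-- The element `∂_i` of `D`. -/
def d {m : ℕ} (i : Fin m) : WeylAlgebra m :=
  ⟨partialD i, Algebra.subset_adjoin (Or.inr ⟨i, rfl⟩)⟩

theorem x_apply {m : ℕ} (i : Fin m) (f : MvPolynomial (Fin m) ℂ) :
    (x i : WeylAlgebra m).1 f = MvPolynomial.X i * f := rfl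

theorem d_apply {m : ℕ} (i : Fin m) (f : MvPolynomial (Fin m) ℂ) :
    (d i : WeylAlgebra m).1 f = MvPolynomial.pderiv i f := rfl

theorem x_comm {m : ℕ} (i j : Fin m) : Commute (x i) (x j) := by
  apply Subtype.ext
  apply LinearMap.ext
  intro f
  change MvPolynomial.X i * (MvPolynomial.X j * f) = MvPolynomial.X j * (MvPolynomial.X i * f)
  ring

theorem d_apply_monomial {m : ℕ} (i : Fin m) (γ : Fin m →₀ ℕ) (c : ℂ) :
    (d i : WeylAlgebra m).1 (MvPolynomial.monomial γ c) =
      MvPolynomial.monomial (γ - Finsupp.single i 1) (c * γ i) := by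
  rw [d_apply, MvPolynomial.pderiv_monomial]

theorem d_comm {m : ℕ} (i j : Fin m) : Commute (d i) (d j) := by
  apply Subtype.ext
  apply MvPolynomial.linearMap_ext
  intro γ
  apply LinearMap.ext
  intro c
  change (d i).1 ((d j).1 (MvPolynomial.monomial γ c)) =
    (d j).1 ((d i).1 (MvPolynomial.monomial γ c))
  simp only [d_apply_monomial]
  by_cases h : i = j
  · subst h; rfl
  · refine congrArg₂ (fun s e => MvPolynomial.monomial s e) ?_ ?_
    · ext k; simp only [Finsupp.coe_tsub, Pi.sub_apply]; omega
    · simp [h, Ne.symm h]; ring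

/-! ### Normally ordered expansions -/

theorem x_pow_comm {m : ℕ} (α : Fin m →₀ ℕ) :
    ((Finset.univ : Finset (Fin m)) : Set (Fin m)).Pairwise
      (Function.onFun Commute fun i => x i ^ α i) :=
  fun i _ j _ _ => (x_comm i j).pow_pow _ _

theorem d_pow_comm {m : ℕ} (β : Fin m →₀ ℕ) :
    ((Finset.univ : Finset (Fin m)) : Set (Fin m)).Pairwise
      (Function.onFun Commute fun i => d i ^ β i) :=
  fun i _ j _ _ => (d_comm i j).pow_pow _ _

/-- `x^α = x_1^{α_1} ⋯ x_m^{α_m}` in `D`. -/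
def xPow {m : ℕ} (α : Fin m →₀ ℕ) : WeylAlgebra m :=
  Finset.univ.noncommProd (fun i => x i ^ α i) (x_pow_comm α)

/-- `∂^β = ∂_1^{β_1} ⋯ ∂_m^{β_m}` in `D`. -/
def dPow {m : ℕ} (β : Fin m →₀ ℕ) : WeylAlgebra m :=
  Finset.univ.noncommProd (fun i => d i ^ β i) (d_pow_comm β)

theorem xPow_zero {m : ℕ} : xPow (0 : Fin m →₀ ℕ) = 1 := by
  unfold xPow
  rw [Finset.noncommProd_eq_pow_card _ _ _ (1 : WeylAlgebra m) (by simp)]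
  simp

theorem dPow_zero {m : ℕ} : dPow (0 : Fin m →₀ ℕ) = 1 := by
  unfold dPow
  rw [Finset.noncommProd_eq_pow_card _ _ _ (1 : WeylAlgebra m) (by simp)]
  simp

theorem xPow_add {m : ℕ} (α β : Fin m →₀ ℕ) : xPow (α + β) = xPow α * xPow β := by
  unfold xPow
  rw [← Finset.noncommProd_mul_distrib _ _ (x_pow_comm α) (x_pow_comm β)
    fun i _ j _ _ => (x_comm i j).pow_pow _ _]
  exact Finset.noncommProd_congr rfl (fun i _ => by simp [pow_add]) _

theorem dPow_add {m : ℕ} (α β : Fin m →₀ ℕ) : dPow (α + β) = dPow α * dPow β := by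
  unfold dPow
  rw [← Finset.noncommProd_mul_distrib _ _ (d_pow_comm α) (d_pow_comm β)
    fun i _ j _ _ => (d_comm i j).pow_pow _ _]
  exact Finset.noncommProd_congr rfl (fun i _ => by simp [pow_add]) _

theorem xPow_single {m : ℕ} (i : Fin m) : xPow (Finsupp.single i 1) = x i := by
  unfold xPow
  refine (Finset.noncommProd_erase_mul _ (Finset.mem_univ i) _ (x_pow_comm _)).symm.trans ?_
  refine (congrArg (· * _) (Finset.noncommProd_eq_pow_card _ _ _ (1 : WeylAlgebra m) ?_)).trans ?_
  · intro j hj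
    simp [(Finset.ne_of_mem_erase hj).symm]
  · simp

theorem dPow_single {m : ℕ} (i : Fin m) : dPow (Finsupp.single i 1) = d i := by
  unfold dPow
  refine (Finset.noncommProd_erase_mul _ (Finset.mem_univ i) _ (d_pow_comm _)).symm.trans ?_
  refine (congrArg (· * _) (Finset.noncommProd_eq_pow_card _ _ _ (1 : WeylAlgebra m) ?_)).trans ?_
  · intro j hj
    simp [(Finset.ne_of_mem_erase hj).symm]
  · simp

/-- Monomials `x^α ξ^β` of `ℂ[x, ξ]`: `Sum.inl i` indexes `x_i` and `Sum.inr i` indexes `ξ_i`. -/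
abbrev Vars (m : ℕ) := Fin m ⊕ Fin m

/-- The exponent of `x` in a monomial `x^α ξ^β`. -/
def xExp {m : ℕ} (s : Vars m →₀ ℕ) : Fin m →₀ ℕ := (Finsupp.sumFinsuppAddEquivProdFinsupp s).1

/-- The exponent of `ξ` in a monomial `x^α ξ^β`. -/
def xiExp {m : ℕ} (s : Vars m →₀ ℕ) : Fin m →₀ ℕ := (Finsupp.sumFinsuppAddEquivProdFinsupp s).2

/-- The `ℂ`-linear map `∑ c_{αβ} x^α ξ^β ↦ ∑ c_{αβ} x^α ∂^β` from `ℂ[x, ξ]` to `D`. -/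
def normalOrder (m : ℕ) : MvPolynomial (Vars m) ℂ →ₗ[ℂ] WeylAlgebra m :=
  (MvPolynomial.basisMonomials (Vars m) ℂ).constr ℂ fun s => xPow (xExp s) * dPow (xiExp s)

theorem normalOrder_monomial {m : ℕ} (s : Vars m →₀ ℕ) (c : ℂ) :
    normalOrder m (MvPolynomial.monomial s c) = c • (xPow (xExp s) * dPow (xiExp s)) := by
  have h : MvPolynomial.monomial s c = c • (MvPolynomial.basisMonomials (Vars m) ℂ) s := by
    rw [MvPolynomial.coe_basisMonomials, MvPolynomial.smul_monomial, smul_eq_mul, mul_one]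
  rw [h, map_smul, normalOrder, Module.Basis.constr_basis]

theorem xPow_mul_dPow_mem {m : ℕ} (α β : Fin m →₀ ℕ) :
    xPow α * dPow β ∈ LinearMap.range (normalOrder m) := by
  refine ⟨MvPolynomial.monomial (Finsupp.sumFinsuppAddEquivProdFinsupp.symm (α, β)) 1, ?_⟩
  rw [normalOrder_monomial, one_smul, xExp, xiExp, AddEquiv.apply_symm_apply]

theorem xPow_apply {m : ℕ} (α : Fin m →₀ ℕ) (f : MvPolynomial (Fin m) ℂ) :
    (xPow α).1 f = MvPolynomial.monomial α 1 * f := by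
  induction α using Finsupp.induction_linear generalizing f with
  | zero => rw [xPow_zero]; simp
  | add α β hα hβ =>
    rw [xPow_add]
    change (xPow α).1 ((xPow β).1 f) = _
    rw [hα, hβ, ← mul_assoc, MvPolynomial.monomial_mul, one_mul]
  | single i n =>
    induction n generalizing f with
    | zero => rw [Finsupp.single_zero, xPow_zero]; simp
    | succ n ih =>
      rw [Finsupp.single_add, xPow_add, xPow_single]
      change (xPow _).1 ((x i).1 f) = _
      rw [ih, x_apply, ← mul_assoc, MvPolynomial.X, MvPolynomial.monomial_mul, one_mul]

theorem d_mul_xPow {m : ℕ} (i : Fin m) (α : Fin m →₀ ℕ) :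
    d i * xPow α = xPow α * d i + (α i : ℂ) • xPow (α - Finsupp.single i 1) := by
  apply Subtype.ext
  apply LinearMap.ext
  intro f
  change (d i).1 ((xPow α).1 f) = (xPow α).1 ((d i).1 f) +
    (α i : ℂ) • (xPow (α - Finsupp.single i 1)).1 f
  simp only [xPow_apply, d_apply]
  rw [Derivation.leibniz, MvPolynomial.pderiv_monomial, smul_eq_mul, smul_eq_mul, one_mul,
    ← smul_mul_assoc, MvPolynomial.smul_monomial, smul_eq_mul, mul_one, mul_comm f]

theorem normalOrder_surjective (m : ℕ) : Function.Surjective (normalOrder m) := by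
  have key : ∀ P ∈ WeylAlgebra m, ∀ Q ∈ LinearMap.range (normalOrder m),
      ∀ P' : WeylAlgebra m, P'.1 = P → P' * Q ∈ LinearMap.range (normalOrder m) := by
    intro P hP
    induction hP using Algebra.adjoin_induction with
    | mem P hP =>
      rintro _ ⟨f, rfl⟩ P' hP'
      induction f using MvPolynomial.induction_on' with
      | add f g hf hg => rw [map_add, mul_add]; exact add_mem hf hg
      | monomial s c =>
        rw [normalOrder_monomial, mul_smul_comm]
        apply Submodule.smul_mem
        rcases hP with ⟨i, rfl⟩ | ⟨i, rfl⟩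
        · obtain rfl : P' = x i := Subtype.ext hP'
          rw [← mul_assoc, ← xPow_single, ← xPow_add]
          exact xPow_mul_dPow_mem _ _
        · obtain rfl : P' = d i := Subtype.ext hP'
          rw [← mul_assoc, d_mul_xPow, add_mul, mul_assoc, smul_mul_assoc, ← dPow_single,
            ← dPow_add]
          exact add_mem (xPow_mul_dPow_mem _ _) (Submodule.smul_mem _ _ (xPow_mul_dPow_mem _ _))
    | algebraMap r =>
      intro Q hQ P' hP'
      obtain rfl : P' = algebraMap ℂ _ r := Subtype.ext hP'
      rw [← Algebra.smul_def]
      exact Submodule.smul_mem _ _ hQ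
    | add P₁ P₂ h₁ h₂ ih₁ ih₂ =>
      intro Q hQ P' hP'
      obtain rfl : P' = ⟨P₁, h₁⟩ + ⟨P₂, h₂⟩ := Subtype.ext hP'
      rw [add_mul]
      exact add_mem (ih₁ Q hQ _ rfl) (ih₂ Q hQ _ rfl)
    | mul P₁ P₂ h₁ h₂ ih₁ ih₂ =>
      intro Q hQ P' hP'
      obtain rfl : P' = ⟨P₁, h₁⟩ * ⟨P₂, h₂⟩ := Subtype.ext hP'
      rw [mul_assoc]
      exact ih₁ _ (ih₂ Q hQ _ rfl) _ rfl
  intro P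
  have h1 : (1 : WeylAlgebra m) ∈ LinearMap.range (normalOrder m) := by
    have := xPow_mul_dPow_mem (0 : Fin m →₀ ℕ) 0
    rwa [xPow_zero, dPow_zero, one_mul] at this
  simpa using key P.1 P.2 1 h1 P rfl

theorem dPow_apply_monomial {m : ℕ} (β γ : Fin m →₀ ℕ) (c : ℂ) :
    (dPow β).1 (MvPolynomial.monomial γ c) =
      MvPolynomial.monomial (γ - β) (c * ∏ i, (((γ i).descFactorial (β i) : ℕ) : ℂ)) := by
  have hsingle : ∀ (i : Fin m) (n : ℕ) (β γ : Fin m →₀ ℕ) (c : ℂ),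
      (dPow β).1 (MvPolynomial.monomial γ c) =
        MvPolynomial.monomial (γ - β) (c * ∏ i, (((γ i).descFactorial (β i) : ℕ) : ℂ)) →
      (dPow (β + Finsupp.single i n)).1 (MvPolynomial.monomial γ c) =
        MvPolynomial.monomial (γ - (β + Finsupp.single i n))
          (c * ∏ j, (((γ j).descFactorial ((β + Finsupp.single i n) j) : ℕ) : ℂ)) := by
    intro i n β γ c h
    induction n with
    | zero => simpa using h
    | succ n ih =>
      have e : β + Finsupp.single i (n + 1) = Finsupp.single i 1 + (β + Finsupp.single i n) := by
        rw [add_comm n 1, Finsupp.single_add]; abel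
      rw [e, dPow_add, dPow_single]
      change (d i).1 ((dPow _).1 _) = _
      rw [ih, d_apply_monomial]
      refine congrArg₂ (fun s e => MvPolynomial.monomial s e) ?_ ?_
      · ext k; simp only [Finsupp.coe_tsub, Finsupp.coe_add, Pi.sub_apply, Pi.add_apply]; omega
      · rw [mul_assoc]
        congr 1
        rw [← Finset.prod_erase_mul Finset.univ
            (fun j => (((γ j).descFactorial ((β + Finsupp.single i n) j) : ℕ) : ℂ))
            (Finset.mem_univ i),
          ← Finset.prod_erase_mul Finset.univ
            (fun j => (((γ j).descFactorial
              ((Finsupp.single i 1 + (β + Finsupp.single i n) : Fin m →₀ ℕ) j) : ℕ) : ℂ))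
            (Finset.mem_univ i), mul_assoc]
        congr 1
        · refine Finset.prod_congr rfl fun j hj => ?_
          have : i ≠ j := (Finset.ne_of_mem_erase hj).symm
          simp [this]
        · have : (Finsupp.single i 1 + (β + Finsupp.single i n) : Fin m →₀ ℕ) i =
              (β + Finsupp.single i n) i + 1 := by simp; omega
          rw [this, Nat.descFactorial_succ, Finsupp.coe_tsub, Pi.sub_apply]
          push_cast
          ring
  induction β using Finsupp.induction with
  | zero => rw [dPow_zero]; simp
  | single_add i n β _ _ ih =>
    rw [add_comm]
    exact hsingle i n β γ c ih

theorem normalOrder_injective (m : ℕ) : Function.Injective (normalOrder m) := by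
  rw [injective_iff_map_eq_zero]
  intro f hf
  by_contra hne
  obtain ⟨s₀, hs₀, hmin⟩ := Finset.exists_min_image f.support
    (fun s => (xiExp s).degree) (MvPolynomial.support_nonempty.mpr hne)
  have h0 : (normalOrder m f).1 (MvPolynomial.monomial (xiExp s₀) 1) = 0 := by rw [hf]; rfl
  rw [f.as_sum, map_sum, AddSubmonoidClass.coe_finsetSum, LinearMap.sum_apply] at h0
  have h1 := congrArg (MvPolynomial.coeff (xExp s₀)) h0
  rw [MvPolynomial.coeff_sum, MvPolynomial.coeff_zero, Finset.sum_eq_single s₀] at h1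
  · rw [normalOrder_monomial] at h1
    change MvPolynomial.coeff _ (f.coeff s₀ • (xPow (xExp s₀)).1 ((dPow (xiExp s₀)).1 _)) = 0 at h1
    rw [dPow_apply_monomial, xPow_apply, MvPolynomial.monomial_mul, tsub_self, add_zero,
      MvPolynomial.coeff_smul, MvPolynomial.coeff_monomial, if_pos rfl] at h1
    simp only [Nat.descFactorial_self, one_mul, smul_eq_mul, mul_eq_zero] at h1
    rcases h1 with h1 | h1
    · exact MvPolynomial.mem_support_iff.mp hs₀ h1
    · rw [Finset.prod_eq_zero_iff] at h1
      obtain ⟨i, _, hi⟩ := h1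
      exact Nat.factorial_ne_zero _ (Nat.cast_eq_zero.mp hi)
  · intro s hs hss
    rw [normalOrder_monomial]
    change MvPolynomial.coeff _ (f.coeff s • (xPow (xExp s)).1 ((dPow (xiExp s)).1 _)) = 0
    rw [dPow_apply_monomial, xPow_apply, MvPolynomial.monomial_mul, MvPolynomial.coeff_smul,
      MvPolynomial.coeff_monomial]
    split_ifs with hx
    · by_cases hle : xiExp s ≤ xiExp s₀
      · exfalso
        have hd := hmin s hs
        have he : xiExp s = xiExp s₀ := by
          have h2 : (xiExp s₀ - xiExp s).degree + (xiExp s).degree = (xiExp s₀).degree := by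
            rw [← map_add, tsub_add_cancel_of_le hle]
          have h3 : (xiExp s₀ - xiExp s).degree = 0 := by omega
          rw [Finsupp.degree_eq_zero_iff] at h3
          exact le_antisymm hle (tsub_eq_zero_iff_le.mp h3)
        rw [he, tsub_self, add_zero] at hx
        apply hss
        apply Finsupp.sumFinsuppAddEquivProdFinsupp.injective
        exact Prod.ext hx he
      · obtain ⟨i, hi⟩ : ∃ i, xiExp s₀ i < xiExp s i := by
          by_contra hcon
          push Not at hcon
          exact hle hcon
        rw [Finset.prod_eq_zero (Finset.mem_univ i)
          (by rw [Nat.descFactorial_of_lt hi, Nat.cast_zero])]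
        simp
    · simp
  · intro h; exact absurd hs₀ h

/-- Every `P ∈ D` has a unique expansion `P = ∑ c_{αβ} x^α ∂^β`; its total symbol is
`∑ c_{αβ} x^α ξ^β ∈ ℂ[x, ξ]`. -/
def symbol (m : ℕ) : WeylAlgebra m ≃ₗ[ℂ] MvPolynomial (Vars m) ℂ :=
  (LinearEquiv.ofBijective (normalOrder m)
    ⟨normalOrder_injective m, normalOrder_surjective m⟩).symm

/-! ### The term order and Gröbner bases -/

/-- The type of exponents of monomials of `ℂ[x, ξ]`, to be ordered by `<_{(0,1)}` with the
tie-breaking term order `t`. -/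
def ZeroOneSyn {m : ℕ} (_t : MonomialOrder (Vars m)) : Type := Vars m →₀ ℕ

instance {m : ℕ} (t : MonomialOrder (Vars m)) : AddCommMonoid (ZeroOneSyn t) :=
  inferInstanceAs (AddCommMonoid (Vars m →₀ ℕ))

/-- The key `(|β|, |α|, x^α ξ^β)` of a monomial, compared lexicographically. -/
def zeroOneKey {m : ℕ} (t : MonomialOrder (Vars m)) (s : Vars m →₀ ℕ) : ℕ ×ₗ (ℕ ×ₗ t.syn) :=
  toLex ((xiExp s).degree, toLex ((xExp s).degree, t.toSyn s))

theorem zeroOneKey_injective {m : ℕ} (t : MonomialOrder (Vars m)) :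
    Function.Injective (zeroOneKey t) := by
  intro s s' h
  simp only [zeroOneKey, EmbeddingLike.apply_eq_iff_eq, Prod.mk.injEq] at h
  exact h.2.2

instance {m : ℕ} (t : MonomialOrder (Vars m)) : LinearOrder (ZeroOneSyn t) :=
  LinearOrder.lift' (fun s : ZeroOneSyn t => zeroOneKey t s) (zeroOneKey_injective t)

theorem xExp_add {m : ℕ} (s s' : Vars m →₀ ℕ) : xExp (s + s') = xExp s + xExp s' := by
  rw [xExp, map_add]; rfl

theorem xiExp_add {m : ℕ} (s s' : Vars m →₀ ℕ) : xiExp (s + s') = xiExp s + xiExp s' := by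
  rw [xiExp, map_add]; rfl

theorem zeroOneKey_add {m : ℕ} (t : MonomialOrder (Vars m)) (s s' : Vars m →₀ ℕ) :
    zeroOneKey t (s + s') = zeroOneKey t s + zeroOneKey t s' := by
  rw [zeroOneKey, xExp_add, xiExp_add, map_add, map_add, map_add]
  rfl

instance {m : ℕ} (t : MonomialOrder (Vars m)) : IsOrderedAddMonoid (ZeroOneSyn t) where
  add_le_add_left s s' h u := by
    have h' : zeroOneKey t s ≤ zeroOneKey t s' := h
    have h'' := add_le_add_left h' (zeroOneKey t u)
    exact (zeroOneKey_add t s u).trans_le (h''.trans_eq (zeroOneKey_add t s' u).symm)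

instance {m : ℕ} (t : MonomialOrder (Vars m)) : WellFoundedLT (ZeroOneSyn t) :=
  ⟨InvImage.wf (zeroOneKey t) wellFounded_lt⟩

/-- The term order `<_{(0,1)}` on monomials `x^α ξ^β`: compare `|β|` first, then `|α|`, then use
the tie-breaking term order `t`. -/
def zeroOneOrder {m : ℕ} (t : MonomialOrder (Vars m)) : MonomialOrder (Vars m) where
  syn := ZeroOneSyn t
  toSyn := { toEquiv := Equiv.refl (Vars m →₀ ℕ), map_add' := fun _ _ => rfl }
  toSyn_monotone s s' h := by
    obtain ⟨u, rfl⟩ := exists_add_of_le h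
    change zeroOneKey t s ≤ zeroOneKey t (s + u)
    simp only [zeroOneKey, xExp_add, xiExp_add, map_add, Prod.Lex.toLex_le_toLex]
    have h3 : t.toSyn s ≤ t.toSyn s + t.toSyn u := t.le_add_right s u
    rcases Nat.eq_zero_or_pos (xiExp u).degree with h1 | h1
    · rcases Nat.eq_zero_or_pos (xExp u).degree with h2 | h2
      · exact Or.inr ⟨by omega, Or.inr ⟨by omega, h3⟩⟩
      · exact Or.inr ⟨by omega, Or.inl (by omega)⟩
    · exact Or.inl (by omega)

theorem zeroOneOrder_lt_iff {m : ℕ} (t : MonomialOrder (Vars m)) (s s' : Vars m →₀ ℕ) :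
    s ≺[zeroOneOrder t] s' ↔
      ∑ i, s (Sum.inr i) < ∑ i, s' (Sum.inr i) ∨
      (∑ i, s (Sum.inr i) = ∑ i, s' (Sum.inr i) ∧ ∑ i, s (Sum.inl i) < ∑ i, s' (Sum.inl i)) ∨
      (∑ i, s (Sum.inr i) = ∑ i, s' (Sum.inr i) ∧ ∑ i, s (Sum.inl i) = ∑ i, s' (Sum.inl i) ∧
        s ≺[t] s') := by
  change zeroOneKey t s < zeroOneKey t s' ↔ _
  simp only [zeroOneKey, Prod.Lex.toLex_lt_toLex, Finsupp.degree_eq_sum]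
  change (∑ i, s (Sum.inr i) < ∑ i, s' (Sum.inr i) ∨ ∑ i, s (Sum.inr i) = ∑ i, s' (Sum.inr i) ∧
    (∑ i, s (Sum.inl i) < ∑ i, s' (Sum.inl i) ∨ ∑ i, s (Sum.inl i) = ∑ i, s' (Sum.inl i) ∧
      t.toSyn s < t.toSyn s')) ↔ _
  tauto

/-- The initial term `in_<(P) ∈ ℂ[x, ξ]` of `P ∈ D` with respect to a term order. -/
def initialTerm {m : ℕ} (o : MonomialOrder (Vars m)) (P : WeylAlgebra m) :
    MvPolynomial (Vars m) ℂ :=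
  o.leadingTerm (symbol m P)

/-- `G` is a Gröbner basis of the left ideal `I` of `D`: it is a finite subset of `D` that
generates `I`, and the initial terms of its elements generate the ideal of `ℂ[x, ξ]` generated by
the initial terms of all elements of `I`. (`Ideal` means left ideal.) -/
def IsGroebnerBasis {m : ℕ} (o : MonomialOrder (Vars m)) (G : Set (WeylAlgebra m))
    (I : Ideal (WeylAlgebra m)) : Prop :=
  G.Finite ∧ Ideal.span G = I ∧
    Ideal.span (initialTerm o '' G) = Ideal.span (initialTerm o '' (I : Set (WeylAlgebra m)))

/-- The `(0,1)`-initial form of `P = ∑ c_{αβ} x^α ∂^β`: the sum of the terms `c_{αβ} x^α ξ^β`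
of the highest weight, where `x_i` has weight `0` and `ξ_i` has weight `1`. -/
def initialForm {m : ℕ} (P : WeylAlgebra m) : MvPolynomial (Vars m) ℂ :=
  let w : Vars m → ℕ := Sum.elim (fun _ => 0) (fun _ => 1)
  MvPolynomial.weightedHomogeneousComponent w
    (MvPolynomial.weightedTotalDegree w (symbol m P)) (symbol m P)

/-! ### Lauricella's operators

The formulas are written for arbitrary elements `x_i`, `∂_i` of a `ℂ`-algebra, with
`θ_i = x_i ∂_i`; they are used in the Weyl algebra and in the algebra of operators on Laurent
polynomials. -/

section Operators

variable {m : ℕ} {A : Type*} [Ring A] [Algebra ℂ A]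

/-- The Euler operator `θ_i = x_i ∂_i`. -/
def euler (x d : Fin m → A) (i : Fin m) : A := x i * d i

/-- `ℓ_i^A = θ_i (θ_i + c_i - 1) - x_i (θ_1 + ⋯ + θ_m + a) (θ_i + b_i)`. -/
def ellA (x d : Fin m → A) (a : ℂ) (b c : Fin m → ℂ) (i : Fin m) : A :=
  euler x d i * (euler x d i + algebraMap ℂ A (c i - 1)) -
    x i * (∑ j, euler x d j + algebraMap ℂ A a) * (euler x d i + algebraMap ℂ A (b i))

/-- `ℓ_i^B = θ_i (θ_1 + ⋯ + θ_m + c - 1) - x_i (θ_i + a_i) (θ_i + b_i)`. -/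
def ellB (x d : Fin m → A) (a b : Fin m → ℂ) (c : ℂ) (i : Fin m) : A :=
  euler x d i * (∑ j, euler x d j + algebraMap ℂ A (c - 1)) -
    x i * (euler x d i + algebraMap ℂ A (a i)) * (euler x d i + algebraMap ℂ A (b i))

/-- `p_i^A = X_i θ_i (-θ_i + c_i - 1) + (θ_1 + ⋯ + θ_m - a) (θ_i - b_i)`. -/
def pA (x d : Fin m → A) (a : ℂ) (b c : Fin m → ℂ) (i : Fin m) : A :=
  x i * euler x d i * (-euler x d i + algebraMap ℂ A (c i - 1)) +
    (∑ j, euler x d j - algebraMap ℂ A a) * (euler x d i - algebraMap ℂ A (b i))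

end Operators

/-! ### The coordinate change `X_i = 1 / x_i` on the torus -/

/-- Laurent polynomials in `m` variables: the regular functions on the torus `(ℂ^*)^m`. -/
abbrev Laurent (m : ℕ) := AddMonoidAlgebra ℂ (Fin m → ℤ)

/-- Multiplication by the `i`-th coordinate, as an operator on Laurent polynomials. -/
def laurentX {m : ℕ} (i : Fin m) : Module.End ℂ (Laurent m) :=
  LinearMap.mulLeft ℂ (AddMonoidAlgebra.single (Pi.single i 1) 1)

/-- The partial derivative with respect to the `i`-th coordinate on Laurent polynomials:
`x^n ↦ n_i x^{n - e_i}`. -/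
def laurentD {m : ℕ} (i : Fin m) : Module.End ℂ (Laurent m) :=
  (AddMonoidAlgebra.basis (Fin m → ℤ) ℂ).constr ℂ fun n =>
    AddMonoidAlgebra.single (n - Pi.single i 1) (n i : ℂ)

/-- The substitution `x_i ↦ 1 / x_i` for all `i`, i.e. `x^n ↦ x^{-n}`, on Laurent polynomials. -/
def laurentInv (m : ℕ) : Laurent m ≃ₐ[ℂ] Laurent m :=
  AddMonoidAlgebra.domCongr ℂ ℂ (AddEquiv.neg (Fin m → ℤ))

/-- The operator that `P` becomes after the coordinate change `X_i = 1 / x_i`. -/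
def invertCoordinates {m : ℕ} (P : Module.End ℂ (Laurent m)) : Module.End ℂ (Laurent m) :=
  (laurentInv m).toLinearEquiv.conj P

end Lauricella

end

open scoped MonomialOrder

noncomputable section

namespace Lauricella

/-! ### The Weyl algebra as an abstract ring -/

/-! The Gröbner statement rests on two features of the operators. In `<_{(0,1)}` the leading term of
p_i is -X_i^3 ξ_i^2: both summands have order 2, but X_i θ_i^2 has a larger X-degree than any θ_j
θ_i. So the leading monomials are pairwise coprime, whatever the tie-breaker. In a noncommutative
ring this does not yet suffice; the missing fact is the exact relation p_j p_i - p_i p_j = B_j p_i -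
B_i p_j with B_k = θ_k - b_k (`pA_mul_pA`). It holds because p_i = A_i + E B_i, where E = ∑ θ_j - a,
the operators A_i = X_i θ_i (-θ_i + c_i - 1) satisfy [E, A_i] = A_i, E commutes with every B_k, and
A_i, B_i commute with A_j, B_j for j ≠ i.

The relation permits rewriting every element of the left ideal as a combination of products x^α ∂^β
p_i in which (α, β) is divisible by no leading monomial of a p_j with j < i
(`normalMonomial_mul_mem_reducedMultiples`). Coprimality makes the leading exponents of these
products distinct (`reducedIndex_add_injective`), so no cancellation occurs at the top and the
leading exponent of a nonzero element is that of one of the products. The computation with leading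
terms uses that D is commutative up to lower order (`normalMonomial_mul_sub_mem`).

The initial forms agree because p_i and ℓ_i^B have the same order-2 part, that of (∑ θ_j) θ_i - X_i
θ_i^2. The coordinate change sends θ_i to -θ_i, and is checked on Laurent monomials, which are
eigenvectors of all θ_i. -/

/-- The ring `D`, with its realization by operators on polynomials hidden. -/
def Weyl (m : ℕ) : Type := WeylAlgebra m

instance (m : ℕ) : Ring (Weyl m) := inferInstanceAs (Ring (WeylAlgebra m))

instance (m : ℕ) : Algebra ℂ (Weyl m) := inferInstanceAs (Algebra ℂ (WeylAlgebra m))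

namespace Weyl

variable {m : ℕ}

/-- The element `x_i` of `D`. -/
def x (i : Fin m) : Weyl m := Lauricella.x i

/-- The element `∂_i` of `D`. -/
def d (i : Fin m) : Weyl m := Lauricella.d i

/-- The element `x^α` of `D`. -/
def xPow (α : Fin m →₀ ℕ) : Weyl m := Lauricella.xPow α

/-- The element `∂^β` of `D`. -/
def dPow (β : Fin m →₀ ℕ) : Weyl m := Lauricella.dPow β

/-- The total symbol of an element of `D`. -/
def symbol (m : ℕ) : Weyl m ≃ₗ[ℂ] MvPolynomial (Vars m) ℂ := Lauricella.symbol m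

theorem x_comm (i j : Fin m) : Commute (x i) (x j) := Lauricella.x_comm i j

theorem xPow_add (α β : Fin m →₀ ℕ) : xPow (α + β) = xPow α * xPow β := Lauricella.xPow_add α β

theorem dPow_zero : dPow (0 : Fin m →₀ ℕ) = 1 := Lauricella.dPow_zero

theorem xPow_zero : xPow (0 : Fin m →₀ ℕ) = 1 := Lauricella.xPow_zero

theorem dPow_add (α β : Fin m →₀ ℕ) : dPow (α + β) = dPow α * dPow β := Lauricella.dPow_add α β

theorem xPow_single (i : Fin m) : xPow (Finsupp.single i 1) = x i := Lauricella.xPow_single i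

theorem dPow_single (i : Fin m) : dPow (Finsupp.single i 1) = d i := Lauricella.dPow_single i

theorem d_mul_xPow (i : Fin m) (α : Fin m →₀ ℕ) :
    d i * xPow α = xPow α * d i + (α i : ℂ) • xPow (α - Finsupp.single i 1) :=
  Lauricella.d_mul_xPow i α

theorem d_comm (i j : Fin m) : Commute (d i) (d j) := Lauricella.d_comm i j

theorem symbol_xPow_mul_dPow (s : Vars m →₀ ℕ) :
    symbol m (xPow (xExp s) * dPow (xiExp s)) = MvPolynomial.monomial s 1 := by
  have h := Lauricella.normalOrder_monomial s 1
  rw [one_smul] at h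
  exact (LinearEquiv.symm_apply_eq _).mpr h.symm

/-! ### Operators whose terms lie in a given set -/

/-- The normally ordered monomial `x^α ∂^β` with exponent `s = (α, β)`. -/
def normalMonomial (s : Vars m →₀ ℕ) : Weyl m := xPow (xExp s) * dPow (xiExp s)

/-- The operators all of whose terms have exponents in `U`. -/
def termsIn (U : Set (Vars m →₀ ℕ)) : Submodule ℂ (Weyl m) :=
  Submodule.span ℂ (normalMonomial '' U)

theorem normalMonomial_mem_termsIn {U : Set (Vars m →₀ ℕ)} {s : Vars m →₀ ℕ}
    (hs : s ∈ U) : normalMonomial s ∈ termsIn U :=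
  Submodule.subset_span ⟨s, hs, rfl⟩

theorem termsIn_mono {U V : Set (Vars m →₀ ℕ)} (h : U ⊆ V) : termsIn U ≤ termsIn V :=
  Submodule.span_mono (Set.image_mono h)

theorem termsIn_le {U : Set (Vars m →₀ ℕ)} {S : Submodule ℂ (Weyl m)}
    (h : ∀ s ∈ U, normalMonomial s ∈ S) : termsIn U ≤ S := by
  rw [termsIn, Submodule.span_le]
  rintro _ ⟨s, hs, rfl⟩
  exact h s hs

theorem mul_mem_of_termsIn {U V : Set (Vars m →₀ ℕ)} {S : Submodule ℂ (Weyl m)}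
    (h : ∀ s ∈ U, ∀ t ∈ V, normalMonomial s * normalMonomial t ∈ S)
    {P Q : Weyl m} (hP : P ∈ termsIn U) (hQ : Q ∈ termsIn V) : P * Q ∈ S := by
  have hle : termsIn U * termsIn V ≤ S := by
    rw [termsIn, termsIn, Submodule.span_mul_span, Submodule.span_le]
    rintro _ ⟨_, ⟨s, hs, rfl⟩, _, ⟨t, ht, rfl⟩, rfl⟩
    exact h s hs t ht
  exact hle (Submodule.mul_mem_mul hP hQ)

theorem symbol_normalMonomial (s : Vars m →₀ ℕ) :
    symbol m (normalMonomial s) = MvPolynomial.monomial s 1 := 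
  symbol_xPow_mul_dPow s

theorem eq_sum_normalMonomial (P : Weyl m) :
    P = ∑ s ∈ (symbol m P).support, (symbol m P).coeff s • normalMonomial s := by
  apply (symbol m).injective
  rw [map_sum]
  conv_lhs => rw [(symbol m P).as_sum]
  refine Finset.sum_congr rfl fun s _ => ?_
  rw [map_smul, symbol_normalMonomial, MvPolynomial.smul_monomial, smul_eq_mul, mul_one]

/-- Links the span description, convenient for products, with coefficients of the symbol, from which
initial terms and initial forms are read. -/
theorem mem_termsIn_iff {U : Set (Vars m →₀ ℕ)} {P : Weyl m} :
    P ∈ termsIn U ↔ ∀ s, (symbol m P).coeff s ≠ 0 → s ∈ U := by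
  constructor
  · intro hP
    induction hP using Submodule.span_induction with
    | mem _ h =>
      obtain ⟨t, ht, rfl⟩ := h
      intro s hs
      rw [symbol_normalMonomial, MvPolynomial.coeff_monomial] at hs
      by_cases hts : t = s
      · exact hts ▸ ht
      · rw [if_neg hts] at hs
        exact absurd rfl hs
    | zero => simp
    | add P Q _ _ hP hQ =>
      intro s hs
      by_contra hU
      rw [map_add, MvPolynomial.coeff_add, not_not.mp (mt (hP s) hU), not_not.mp (mt (hQ s) hU),
        add_zero] at hs
      exact hs rfl
    | smul r P _ hP =>
      intro s hs
      rw [map_smul, MvPolynomial.coeff_smul] at hs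
      exact hP s (right_ne_zero_of_smul hs)
  · intro h
    rw [eq_sum_normalMonomial P]
    exact Submodule.sum_mem _ fun s hs => Submodule.smul_mem _ _
      (normalMonomial_mem_termsIn (h s (MvPolynomial.mem_support_iff.mp hs)))

theorem mem_termsIn_univ (P : Weyl m) : P ∈ termsIn Set.univ :=
  mem_termsIn_iff.mpr fun _ _ => Set.mem_univ _

/-! ### The order filtration -/

/-- The operators of order less than `n`. -/
def orderLT (m n : ℕ) : Submodule ℂ (Weyl m) := termsIn {s | (xiExp s).degree < n}

theorem orderLT_mono {k n : ℕ} (h : k ≤ n) : orderLT m k ≤ orderLT m n :=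
  termsIn_mono fun _ hs => lt_of_lt_of_le hs h

theorem exists_normalMonomial_eq (α β : Fin m →₀ ℕ) :
    ∃ s : Vars m →₀ ℕ, xExp s = α ∧ xiExp s = β ∧ xPow α * dPow β = normalMonomial s := by
  have hx : xExp (Finsupp.sumFinsuppAddEquivProdFinsupp.symm (α, β)) = α := by
    rw [xExp, AddEquiv.apply_symm_apply]
  have hxi : xiExp (Finsupp.sumFinsuppAddEquivProdFinsupp.symm (α, β)) = β := by
    rw [xiExp, AddEquiv.apply_symm_apply]
  exact ⟨_, hx, hxi, by rw [normalMonomial, hx, hxi]⟩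

theorem xPow_mul_dPow_mem_orderLT {n : ℕ} (α β : Fin m →₀ ℕ) (h : β.degree < n) :
    xPow α * dPow β ∈ orderLT m n := by
  obtain ⟨s, _, hs, e⟩ := exists_normalMonomial_eq α β
  rw [e]
  exact normalMonomial_mem_termsIn (by rwa [Set.mem_ofPred_eq, hs])

theorem orderLT_induction {n : ℕ} {S : Submodule ℂ (Weyl m)}
    (f : Weyl m →ₗ[ℂ] Weyl m)
    (h : ∀ α β : Fin m →₀ ℕ, β.degree < n → f (xPow α * dPow β) ∈ S)
    {P : Weyl m} (hP : P ∈ orderLT m n) : f P ∈ S :=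
  (termsIn_le (S := S.comap f) fun _ hs => h _ _ hs) hP

theorem xPow_mul_mem_orderLT {n : ℕ} (α : Fin m →₀ ℕ) {P : Weyl m}
    (hP : P ∈ orderLT m n) : xPow α * P ∈ orderLT m n :=
  orderLT_induction (LinearMap.mulLeft ℂ (xPow α)) (fun γ δ h => by
    rw [LinearMap.mulLeft_apply, ← mul_assoc, ← xPow_add]
    exact xPow_mul_dPow_mem_orderLT _ _ h) hP

theorem mul_dPow_mem_orderLT {n : ℕ} (β : Fin m →₀ ℕ) {P : Weyl m}
    (hP : P ∈ orderLT m n) : P * dPow β ∈ orderLT m (n + β.degree) :=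
  orderLT_induction (LinearMap.mulRight ℂ (dPow β)) (fun γ δ h => by
    rw [LinearMap.mulRight_apply, mul_assoc, ← dPow_add]
    exact xPow_mul_dPow_mem_orderLT _ _ (by rw [map_add]; omega)) hP

theorem d_mul_mem_orderLT {n : ℕ} (i : Fin m) {P : Weyl m}
    (hP : P ∈ orderLT m n) : d i * P ∈ orderLT m (n + 1) :=
  orderLT_induction (LinearMap.mulLeft ℂ (d i)) (fun γ δ h => by
    rw [LinearMap.mulLeft_apply, ← mul_assoc, d_mul_xPow, add_mul, mul_assoc, smul_mul_assoc,
      ← dPow_single, ← dPow_add]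
    refine add_mem (xPow_mul_dPow_mem_orderLT _ _ ?_)
      (Submodule.smul_mem _ _ (xPow_mul_dPow_mem_orderLT _ _ (by omega)))
    rw [map_add, Finsupp.degree_single]
    omega) hP

theorem dPow_mul_mem_orderLT (β : Fin m →₀ ℕ) :
    ∀ {n : ℕ} {P : Weyl m}, P ∈ orderLT m n → dPow β * P ∈ orderLT m (n + β.degree) := by
  induction β using Finsupp.induction_linear with
  | zero => intro n P hP; simpa [dPow_zero] using hP
  | add β γ hβ hγ =>
    intro n P hP
    rw [dPow_add, mul_assoc, map_add, add_comm β.degree, ← add_assoc]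
    exact hβ (hγ hP)
  | single i k =>
    induction k with
    | zero => intro n P hP; simpa [dPow_zero] using hP
    | succ k ih =>
      intro n P hP
      rw [add_comm k, Finsupp.single_add, dPow_add, mul_assoc, dPow_single, map_add,
        Finsupp.degree_single i 1, add_comm 1, ← add_assoc]
      exact d_mul_mem_orderLT i (ih hP)

/-- The commutator with x^γ is a derivation in ∂^β, so the claim reduces to a single ∂_i. The strict
bound also covers β = 0, where the commutator vanishes. -/
theorem dPow_commutator_xPow_mem_orderLT (β γ : Fin m →₀ ℕ) :
    dPow β * xPow γ - xPow γ * dPow β ∈ orderLT m β.degree := by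
  have hadd : ∀ β δ : Fin m →₀ ℕ, dPow β * xPow γ - xPow γ * dPow β ∈ orderLT m β.degree →
      dPow δ * xPow γ - xPow γ * dPow δ ∈ orderLT m δ.degree →
      dPow (β + δ) * xPow γ - xPow γ * dPow (β + δ) ∈ orderLT m (β + δ).degree := by
    intro β δ hβ hδ
    have e : dPow (β + δ) * xPow γ - xPow γ * dPow (β + δ) =
        dPow β * (dPow δ * xPow γ - xPow γ * dPow δ) +
          (dPow β * xPow γ - xPow γ * dPow β) * dPow δ := by
      rw [dPow_add]
      noncomm_ring
    rw [e, map_add]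
    refine add_mem ?_ (mul_dPow_mem_orderLT δ hβ)
    rw [add_comm β.degree]
    exact dPow_mul_mem_orderLT β hδ
  induction β using Finsupp.induction_linear with
  | zero => simp [dPow_zero]
  | add β δ hβ hδ => exact hadd β δ hβ hδ
  | single i k =>
    induction k with
    | zero => simp [dPow_zero]
    | succ k ih =>
      rw [Finsupp.single_add]
      refine hadd _ _ ih ?_
      rw [dPow_single, d_mul_xPow, add_sub_cancel_left, Finsupp.degree_single]
      apply Submodule.smul_mem
      have := xPow_mul_dPow_mem_orderLT (n := 1) (γ - Finsupp.single i 1) 0 (by simp)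
      rwa [dPow_zero, mul_one] at this

/-- Commutativity of the associated graded ring: normal ordering a product only requires moving ∂^β
past x^γ, which costs terms of lower order. -/
theorem normalMonomial_mul_sub_mem (s t : Vars m →₀ ℕ) :
    normalMonomial s * normalMonomial t - normalMonomial (s + t) ∈
      orderLT m (xiExp (s + t)).degree := by
  have e : normalMonomial s * normalMonomial t - normalMonomial (s + t) =
      xPow (xExp s) * ((dPow (xiExp s) * xPow (xExp t) - xPow (xExp t) * dPow (xiExp s)) *
        dPow (xiExp t)) := by
    rw [normalMonomial, normalMonomial, normalMonomial, xExp_add, xiExp_add, xPow_add, dPow_add]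
    noncomm_ring
  rw [e, xiExp_add, map_add]
  exact xPow_mul_mem_orderLT _ (mul_dPow_mem_orderLT _ (dPow_commutator_xPow_mem_orderLT _ _))

-- The shifts by one turn the strict bounds into additivity of orders: order at most k times order
-- at most n.
theorem mul_mem_orderLT {k n : ℕ} {P Q : Weyl m} (hP : P ∈ orderLT m (k + 1))
    (hQ : Q ∈ orderLT m (n + 1)) : P * Q ∈ orderLT m (k + n + 1) := by
  refine mul_mem_of_termsIn (fun s hs t ht => ?_) hP hQ
  rw [Set.mem_ofPred_eq] at hs ht
  have hst : (xiExp (s + t)).degree < k + n + 1 := by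
    rw [xiExp_add, map_add]
    omega
  rw [← sub_add_cancel (normalMonomial s * normalMonomial t) (normalMonomial (s + t))]
  exact add_mem (orderLT_mono hst.le (normalMonomial_mul_sub_mem s t))
    (normalMonomial_mem_termsIn hst)

/-! ### Leading terms -/

section Leading

variable (t : MonomialOrder (Vars m))

/-- The operators all of whose terms are smaller than `s` with respect to `<_{(0,1)}`. -/
def below (s : Vars m →₀ ℕ) : Submodule ℂ (Weyl m) :=
  termsIn {u | u ≺[zeroOneOrder t] s}

/-- The operators all of whose terms are at most `s` with respect to `<_{(0,1)}`. -/
def upTo (s : Vars m →₀ ℕ) : Submodule ℂ (Weyl m) :=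
  termsIn {u | u ≼[zeroOneOrder t] s}

/-- The term of `P` with exponent `s` has coefficient `r`, and all other terms are smaller. -/
def LeadsWith (P : Weyl m) (s : Vars m →₀ ℕ) (r : ℂ) : Prop :=
  P - r • normalMonomial s ∈ below t s

variable {t}

theorem lt_of_degree_xiExp_lt {u s : Vars m →₀ ℕ} (h : (xiExp u).degree < (xiExp s).degree) :
    u ≺[zeroOneOrder t] s := by
  rw [zeroOneOrder_lt_iff]
  rw [Finsupp.degree_eq_sum, Finsupp.degree_eq_sum] at h
  exact Or.inl h

theorem orderLT_le_below (s : Vars m →₀ ℕ) : orderLT m (xiExp s).degree ≤ below t s :=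
  termsIn_mono fun _ h => lt_of_degree_xiExp_lt h

theorem below_le_upTo (s : Vars m →₀ ℕ) : below t s ≤ upTo t s :=
  termsIn_mono fun u (h : u ≺[zeroOneOrder t] s) => le_of_lt h

theorem below_mono {u s : Vars m →₀ ℕ} (h : u ≼[zeroOneOrder t] s) : below t u ≤ below t s :=
  termsIn_mono fun v (hv : v ≺[zeroOneOrder t] u) => lt_of_lt_of_le hv h

theorem upTo_mono {u s : Vars m →₀ ℕ} (h : u ≼[zeroOneOrder t] s) : upTo t u ≤ upTo t s :=
  termsIn_mono fun v (hv : v ≼[zeroOneOrder t] u) => le_trans hv h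

theorem upTo_le_below {u s : Vars m →₀ ℕ} (h : u ≺[zeroOneOrder t] s) : upTo t u ≤ below t s :=
  termsIn_mono fun v (hv : v ≼[zeroOneOrder t] u) => lt_of_le_of_lt hv h

theorem normalMonomial_mul_mem_upTo (u s : Vars m →₀ ℕ) :
    normalMonomial u * normalMonomial s ∈ upTo t (u + s) := by
  rw [← sub_add_cancel (normalMonomial u * normalMonomial s) (normalMonomial (u + s))]
  exact add_mem (below_le_upTo _ (orderLT_le_below _ (normalMonomial_mul_sub_mem u s)))
    (normalMonomial_mem_termsIn (le_refl ((zeroOneOrder t).toSyn _)))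

theorem upTo_mul_upTo {u s : Vars m →₀ ℕ} {P Q : Weyl m} (hP : P ∈ upTo t u)
    (hQ : Q ∈ upTo t s) : P * Q ∈ upTo t (u + s) :=
  mul_mem_of_termsIn (fun v hv w hw => upTo_mono (by
    rw [map_add, map_add]
    exact add_le_add hv hw) (normalMonomial_mul_mem_upTo v w)) hP hQ

theorem below_mul_upTo {u s : Vars m →₀ ℕ} {P Q : Weyl m} (hP : P ∈ below t u)
    (hQ : Q ∈ upTo t s) : P * Q ∈ below t (u + s) :=
  mul_mem_of_termsIn (fun v hv w hw => upTo_le_below (by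
    rw [map_add, map_add]
    exact add_lt_add_of_lt_of_le hv hw) (normalMonomial_mul_mem_upTo v w)) hP hQ

theorem upTo_mul_below {u s : Vars m →₀ ℕ} {P Q : Weyl m} (hP : P ∈ upTo t u)
    (hQ : Q ∈ below t s) : P * Q ∈ below t (u + s) :=
  mul_mem_of_termsIn (fun v hv w hw => upTo_le_below (by
    rw [map_add, map_add]
    exact add_lt_add_of_le_of_lt hv hw) (normalMonomial_mul_mem_upTo v w)) hP hQ

theorem leadsWith_normalMonomial (s : Vars m →₀ ℕ) : LeadsWith t (normalMonomial s) s 1 := by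
  rw [LeadsWith, one_smul, sub_self]
  exact zero_mem _

theorem LeadsWith.mem_upTo {P : Weyl m} {s : Vars m →₀ ℕ} {r : ℂ}
    (h : LeadsWith t P s r) : P ∈ upTo t s := by
  rw [← sub_add_cancel P (r • normalMonomial s)]
  exact add_mem (below_le_upTo _ h)
    (Submodule.smul_mem _ _ (normalMonomial_mem_termsIn (le_refl ((zeroOneOrder t).toSyn _))))

/-- Replacing P, then Q, by its leading part leaves errors below s + u; normal ordering the product
of the two monomials changes it only in lower order. -/
theorem LeadsWith.mul {P Q : Weyl m} {s u : Vars m →₀ ℕ} {r r' : ℂ}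
    (hP : LeadsWith t P s r) (hQ : LeadsWith t Q u r') : LeadsWith t (P * Q) (s + u) (r * r') := by
  have e : P * Q - (r * r') • normalMonomial (s + u) =
      (P - r • normalMonomial s) * Q + (r • normalMonomial s) * (Q - r' • normalMonomial u) +
        (r * r') • (normalMonomial s * normalMonomial u - normalMonomial (s + u)) := by
    simp only [sub_mul, mul_sub, smul_sub, smul_mul_smul_comm]
    abel
  rw [LeadsWith, e]
  exact add_mem (add_mem (below_mul_upTo hP hQ.mem_upTo)
    (upTo_mul_below (Submodule.smul_mem _ _ (normalMonomial_mem_termsIn (le_refl ((zeroOneOrder t).toSyn _)))) hQ))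
    (Submodule.smul_mem _ _ (orderLT_le_below _ (normalMonomial_mul_sub_mem s u)))

theorem LeadsWith.add_of_mem_below {P Q : Weyl m} {s : Vars m →₀ ℕ} {r : ℂ}
    (hP : LeadsWith t P s r) (hQ : Q ∈ below t s) : LeadsWith t (P + Q) s r := by
  rw [LeadsWith, add_sub_right_comm]
  exact add_mem hP hQ

theorem LeadsWith.smul {P : Weyl m} {s : Vars m →₀ ℕ} {r : ℂ} (k : ℂ)
    (hP : LeadsWith t P s r) : LeadsWith t (k • P) s (k * r) := by
  rw [LeadsWith, mul_smul, ← smul_sub]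
  exact Submodule.smul_mem _ _ hP

theorem LeadsWith.neg {P : Weyl m} {s : Vars m →₀ ℕ} {r : ℂ}
    (hP : LeadsWith t P s r) : LeadsWith t (-P) s (-r) := by
  simpa using hP.smul (-1)

theorem LeadsWith.coeff_symbol {P : Weyl m} {s : Vars m →₀ ℕ} {r : ℂ}
    (h : LeadsWith t P s r) : (symbol m P).coeff s = r := by
  have hs := mt (mem_termsIn_iff.mp h s) (lt_irrefl ((zeroOneOrder t).toSyn s))
  rwa [not_not, map_sub, map_smul, symbol_normalMonomial, MvPolynomial.coeff_sub,
    MvPolynomial.coeff_smul, MvPolynomial.coeff_monomial, if_pos rfl, smul_eq_mul, mul_one,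
    sub_eq_zero] at hs

/-- `LeadsWith` permits the coefficient 0, so `hr` is needed to identify the true initial term. -/
theorem LeadsWith.leadingTerm_eq {P : Weyl m} {s : Vars m →₀ ℕ} {r : ℂ}
    (h : LeadsWith t P s r) (hr : r ≠ 0) :
    (zeroOneOrder t).leadingTerm (symbol m P) = MvPolynomial.monomial s r := by
  have hdeg : (zeroOneOrder t).degree (symbol m P) = s := by
    apply (zeroOneOrder t).toSyn.injective
    apply le_antisymm
    · rw [MonomialOrder.degree_le_iff]
      intro u hu
      exact mem_termsIn_iff.mp h.mem_upTo u (MvPolynomial.mem_support_iff.mp hu)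
    · apply MonomialOrder.le_degree
      rw [MvPolynomial.mem_support_iff, h.coeff_symbol]
      exact hr
  rw [MonomialOrder.leadingTerm, MonomialOrder.leadingCoeff, hdeg, h.coeff_symbol]

/-- If finitely many operators have distinct leading exponents, one of these is the leading
exponent of any nonzero linear combination. -/
theorem exists_leadsWith_sum {ι : Type*} (v : ι → Weyl m) (e : ι → Vars m →₀ ℕ)
    (r : ι → ℂ) (hv : ∀ k, LeadsWith t (v k) (e k) (r k)) (he : Function.Injective e)
    (A : Finset ι) (hA : A.Nonempty) (z : ι → ℂ) :
    ∃ k ∈ A, LeadsWith t (∑ k ∈ A, z k • v k) (e k) (z k * r k) := by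
  classical
  obtain ⟨k, hk, hmax⟩ := A.exists_max_image (fun k => (zeroOneOrder t).toSyn (e k)) hA
  refine ⟨k, hk, ?_⟩
  rw [← Finset.add_sum_erase A _ hk]
  refine ((hv k).smul _).add_of_mem_below (Submodule.sum_mem _ fun l hl => ?_)
  obtain ⟨hlk, hlA⟩ := Finset.mem_erase.mp hl
  refine Submodule.smul_mem _ _ (upTo_le_below (lt_of_le_of_ne (hmax l hlA) fun h => ?_)
    (hv l).mem_upTo)
  exact hlk (he ((zeroOneOrder t).toSyn.injective h))

end Leading

end Weyl

end Lauricella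

end

noncomputable section

namespace Lauricella

namespace Weyl

variable {m : ℕ}

/-! ### A Gröbner basis criterion -/

section Criterion

variable (p : Fin m → Weyl m) (u : Fin m → Vars m →₀ ℕ)

/-- The pairs `(s, i)` such that no `u_j` with `j < i` divides the monomial with exponent `s`. -/
def ReducedIndex : Type :=
  {k : (Vars m →₀ ℕ) × Fin m // ∀ j < k.2, ¬ u j ≤ k.1}

/-- The span of the products `x^α ∂^β p_i` with `(α, β)` not divisible by any `u_j`, `j < i`. -/
def reducedMultiples : Submodule ℂ (Weyl m) :=
  Submodule.span ℂ (Set.range fun k : ReducedIndex u => normalMonomial k.1.1 * p k.1.2)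

variable {p u} {t : MonomialOrder (Vars m)} {r : Fin m → ℂ}

/-- If u_j divides s for some j < i, the monomial is, up to smaller terms, a multiple of p_j. The
second expression for p_j p_i then trades the product for one ending in p_j, plus strictly smaller
multiples of p_i. -/
theorem normalMonomial_mul_mem_reducedMultiples (hr : ∀ i, r i ≠ 0)
    (hp : ∀ i, LeadsWith t (p i) (u i) (r i))
    (hcomm : ∀ i j, j < i → ∃ C ∈ upTo t (u i), ∃ C' ∈ below t (u j),
      p j * p i = C * p j + C' * p i)
    (s : Vars m →₀ ℕ) (i : Fin m) : normalMonomial s * p i ∈ reducedMultiples p u := by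
  -- The outer induction is on the exponent s + u_i, the inner one on i: a rewriting step lowers the
  -- former, or keeps it and lowers the index.
  suffices h : ∀ T : (zeroOneOrder t).syn, ∀ i s, (zeroOneOrder t).toSyn (s + u i) = T →
      normalMonomial s * p i ∈ reducedMultiples p u from h _ i s rfl
  intro T
  induction T using WellFoundedLT.induction with
  | ind T ihT =>
  intro i
  induction i using WellFoundedLT.induction with
  | ind i ihi =>
  rintro s rfl
  by_cases hs : ∀ j < i, ¬ u j ≤ s
  · exact Submodule.subset_span ⟨⟨(s, i), hs⟩, rfl⟩
  push Not at hs
  obtain ⟨j, hji, hjs⟩ := hs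
  obtain ⟨s', rfl⟩ := exists_add_of_le hjs
  have hlow : ∀ Q ∈ below t (u j + s'), Q * p i ∈ reducedMultiples p u := fun Q hQ =>
    termsIn_le (S := (reducedMultiples p u).comap (LinearMap.mulRight ℂ (p i)))
      (fun v (hv : v ≺[zeroOneOrder t] _) => ihT _ (by
        rw [map_add, map_add]
        exact add_lt_add_left hv _) i v rfl) hQ
  have hprev : ∀ Q ∈ upTo t (s' + u i), Q * p j ∈ reducedMultiples p u := fun Q hQ =>
    termsIn_le (S := (reducedMultiples p u).comap (LinearMap.mulRight ℂ (p j)))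
      (fun v (hv : v ≼[zeroOneOrder t] _) => by
        have hle : (zeroOneOrder t).toSyn (v + u j) ≤ (zeroOneOrder t).toSyn (u j + s' + u i) := by
          rw [add_assoc, add_comm (u j), map_add, map_add _ (s' + u i)]
          exact add_le_add_left hv _
        rcases hle.lt_or_eq with hlt | heq
        · exact ihT _ hlt j v rfl
        · exact ihi j hji v heq) hQ
  obtain ⟨C, hC, C', hC', e⟩ := hcomm i j hji
  have hs' : normalMonomial s' ∈ upTo t s' := (leadsWith_normalMonomial s').mem_upTo
  -- Dividing by r_j makes x^{s'} p_j monic, so it differs from the monomial u_j + s' only by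
  -- smaller terms.
  have hR := ((leadsWith_normalMonomial (t := t) s').mul (hp j)).smul (r j)⁻¹
  rw [one_mul, inv_mul_cancel₀ (hr j), add_comm s', LeadsWith, one_smul] at hR
  have key : normalMonomial (u j + s') * p i =
      (r j)⁻¹ • (normalMonomial s' * C * p j + normalMonomial s' * C' * p i) -
        ((r j)⁻¹ • (normalMonomial s' * p j) - normalMonomial (u j + s')) * p i := by
    rw [sub_mul, smul_mul_assoc, mul_assoc (normalMonomial s') (p j), e, mul_add, ← mul_assoc,
      ← mul_assoc]
    abel
  rw [key]
  refine sub_mem (Submodule.smul_mem _ _ (add_mem ?_ ?_)) (hlow _ hR)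
  · exact hprev _ (upTo_mul_upTo hs' hC)
  · refine hlow _ ?_
    rw [add_comm]
    exact upTo_mul_below hs' hC'

theorem mul_mem_reducedMultiples (hr : ∀ i, r i ≠ 0)
    (hp : ∀ i, LeadsWith t (p i) (u i) (r i))
    (hcomm : ∀ i j, j < i → ∃ C ∈ upTo t (u i), ∃ C' ∈ below t (u j),
      p j * p i = C * p j + C' * p i)
    (Q : Weyl m) (i : Fin m) : Q * p i ∈ reducedMultiples p u :=
  termsIn_le (S := (reducedMultiples p u).comap (LinearMap.mulRight ℂ (p i)))
    (fun s _ => normalMonomial_mul_mem_reducedMultiples hr hp hcomm s i) (mem_termsIn_univ Q)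

/-- If two exponents agree and the indices satisfy i < j, coprimality forces u_i to divide the
cofactor of p_j, which is excluded for a reduced pair. -/
theorem reducedIndex_add_injective (hu : ∀ i j, i ≠ j → ∀ k, u i k = 0 ∨ u j k = 0) :
    Function.Injective fun k : ReducedIndex u => k.1.1 + u k.1.2 := by
  have hlt : ∀ k l : ReducedIndex u, k.1.1 + u k.1.2 = l.1.1 + u l.1.2 → ¬ k.1.2 < l.1.2 := by
    intro k l h hkl
    refine l.2 _ hkl fun v => ?_
    have hv := DFunLike.congr_fun h v
    simp only [Finsupp.add_apply] at hv
    rcases hu _ _ hkl.ne v with h0 | h0 <;> omega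
  rintro k l h
  have hkl : k.1.2 = l.1.2 := le_antisymm (not_lt.mp (hlt l k h.symm)) (not_lt.mp (hlt k l h))
  refine Subtype.ext (Prod.ext ?_ hkl)
  dsimp only at h
  rw [hkl] at h
  exact add_right_cancel h

/-- If the leading monomials `u_i` of the `p_i` are pairwise coprime and the products `p_j p_i`
have suitable second expressions, every nonzero element of the left ideal generated by the `p_i` has
a leading monomial divisible by some `u_i`. -/
theorem exists_leadsWith_of_mem_span (hr : ∀ i, r i ≠ 0)
    (hp : ∀ i, LeadsWith t (p i) (u i) (r i))
    (hu : ∀ i j, i ≠ j → ∀ k, u i k = 0 ∨ u j k = 0)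
    (hcomm : ∀ i j, j < i → ∃ C ∈ upTo t (u i), ∃ C' ∈ below t (u j),
      p j * p i = C * p j + C' * p i)
    (Q : Fin m → Weyl m) (hQ : ∑ i, Q i * p i ≠ 0) :
    ∃ i s z, u i ≤ s ∧ z ≠ 0 ∧ LeadsWith t (∑ i, Q i * p i) s z := by
  have hmem : ∑ i, Q i * p i ∈ reducedMultiples p u :=
    Submodule.sum_mem _ fun i _ => mul_mem_reducedMultiples hr hp hcomm (Q i) i
  obtain ⟨z, hz⟩ := (Finsupp.mem_span_range_iff_exists_finsupp).mp hmem
  have hne : z.support.Nonempty := by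
    rw [Finsupp.support_nonempty_iff]
    rintro rfl
    exact hQ (by rw [← hz, Finsupp.sum_zero_index])
  obtain ⟨k, hk, hlead⟩ := exists_leadsWith_sum (t := t)
    (fun k : ReducedIndex u => normalMonomial k.1.1 * p k.1.2) (fun k => k.1.1 + u k.1.2)
    (fun k => 1 * r k.1.2) (fun k => (leadsWith_normalMonomial _).mul (hp _))
    (reducedIndex_add_injective hu) z.support hne z
  rw [one_mul] at hlead
  rw [← hz]
  exact ⟨k.1.2, _, _, le_add_self, mul_ne_zero (Finsupp.mem_support_iff.mp hk) (hr _), hlead⟩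

end Criterion

/-! ### Commutation relations -/

/-- The Euler operator `θ_i` of `D`. -/
def theta (i : Fin m) : Weyl m := euler x d i

theorem d_mul_x_self (i : Fin m) : d i * x i = x i * d i + 1 := by
  have h := d_mul_xPow i (Finsupp.single i 1)
  rwa [xPow_single, tsub_self, xPow_zero, Finsupp.single_eq_same, Nat.cast_one, one_smul] at h

theorem d_x_commute {i j : Fin m} (h : i ≠ j) : Commute (d i) (x j) := by
  have e := d_mul_xPow i (Finsupp.single j 1)
  rwa [xPow_single, Finsupp.single_eq_of_ne h, Nat.cast_zero, zero_smul, add_zero] at e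

theorem theta_mul_x_self (i : Fin m) : theta i * x i = x i * theta i + x i := by
  rw [theta, euler, mul_assoc, d_mul_x_self, mul_add, mul_one]

theorem theta_x_commute {i j : Fin m} (h : i ≠ j) : Commute (theta i) (x j) :=
  (x_comm i j).mul_left (d_x_commute h)

theorem theta_comm (i j : Fin m) : Commute (theta i) (theta j) := by
  rcases eq_or_ne i j with rfl | h
  · exact Commute.refl _
  · exact (theta_x_commute h).mul_right ((d_x_commute h.symm).symm.mul_left (d_comm i j))

theorem sum_theta_comm (i : Fin m) : Commute (∑ j, theta j) (theta i) :=
  Commute.sum_left _ _ _ fun j _ => theta_comm j i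

theorem sum_theta_mul_x (i : Fin m) : (∑ j, theta j) * x i = x i * ∑ j, theta j + x i := by
  rw [Finset.sum_mul, Finset.mul_sum, ← Finset.add_sum_erase _ _ (Finset.mem_univ i),
    ← Finset.add_sum_erase _ (fun j => x i * theta j) (Finset.mem_univ i), theta_mul_x_self,
    Finset.sum_congr rfl fun j hj => (theta_x_commute (Finset.ne_of_mem_erase hj)).eq]
  abel

/-- With p = a + e b and p' = a' + e b', this says [p', p] = b' p - b p'. Only the products of e
with a and a' fail to commute, and each contributes one correction. -/
theorem commutator_identity {A : Type*} [Ring A] {e a a' b b' : A} (haa : Commute a a')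
    (hab : Commute a b') (hba : Commute b a') (hbb : Commute b b') (heb : Commute e b)
    (heb' : Commute e b') (hea : e * a = a * e + a) (hea' : e * a' = a' * e + a') :
    (a' + e * b') * (a + e * b) = (a + e * b - b) * (a' + e * b') + b' * (a + e * b) := by
  have h1 : a' * a = a * a' := haa.eq.symm
  have h2 : a' * e * b = e * (b * a') - b * a' := by
    rw [eq_sub_of_add_eq hea'.symm, sub_mul, mul_assoc, hba.eq]
  have h3 : a * e * b' = e * b' * a - b' * a := by
    rw [eq_sub_of_add_eq hea.symm, sub_mul, mul_assoc, hab.eq, mul_assoc]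
  have h4 : b' * e * b = b * e * b' := by
    rw [← heb'.eq, ← heb.eq, mul_assoc, mul_assoc, hbb.eq]
  calc (a' + e * b') * (a + e * b)
      = a' * a + a' * e * b + e * b' * a + e * (b' * e * b) := by noncomm_ring
    _ = a * a' + (e * b' * a - b' * a) + e * (b * a') + e * (b * e * b') - b * a' -
          b * e * b' + b' * a + b * e * b' := by rw [h1, h2, h4]; abel
    _ = a * a' + a * e * b' + e * (b * a') + e * (b * e * b') - b * a' -
          b * e * b' + b' * a + b' * e * b := by rw [h3, h4]
    _ = (a + e * b - b) * (a' + e * b') + b' * (a + e * b) := by noncomm_ring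

section Operators

variable (a : ℂ) (b c : Fin m → ℂ)

theorem pA_eq (i : Fin m) : pA x d a b c i =
    x i * theta i * (-theta i + algebraMap ℂ (Weyl m) (c i - 1)) +
      (∑ j, theta j - algebraMap ℂ (Weyl m) a) * (theta i - algebraMap ℂ (Weyl m) (b i)) := rfl

theorem pA_mul_pA {i j : Fin m} (h : i ≠ j) : pA x d a b c j * pA x d a b c i =
    (pA x d a b c i - (theta i - algebraMap ℂ (Weyl m) (b i))) * pA x d a b c j +
      (theta j - algebraMap ℂ (Weyl m) (b j)) * pA x d a b c i := by
  have hthX : ∀ {i j : Fin m}, i ≠ j → Commute (x i * theta i *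
      (-theta i + algebraMap ℂ (Weyl m) (c i - 1))) (theta j) := fun {i j} h =>
    ((theta_x_commute h.symm).symm.mul_left (theta_comm i j)).mul_left
      ((theta_comm i j).neg_left.add_left (Algebra.commutes _ _))
  have hconst : ∀ (z : ℂ) (P : Weyl m), Commute P (algebraMap ℂ (Weyl m) z) :=
    fun z P => (Algebra.commutes z P).symm
  have hEth : ∀ i, Commute (∑ j, theta j - algebraMap ℂ (Weyl m) a) (theta i) :=
    fun i => (sum_theta_comm i).sub_left (hconst _ _).symm
  -- The factor x_i raises the Euler degree by 1 and the θ_i preserve it, so this operator is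
  -- homogeneous of degree 1.
  have hEA : ∀ i, (∑ j, theta j - algebraMap ℂ (Weyl m) a) *
      (x i * theta i * (-theta i + algebraMap ℂ (Weyl m) (c i - 1))) =
      x i * theta i * (-theta i + algebraMap ℂ (Weyl m) (c i - 1)) *
        (∑ j, theta j - algebraMap ℂ (Weyl m) a) +
      x i * theta i * (-theta i + algebraMap ℂ (Weyl m) (c i - 1)) := by
    intro i
    have hx : (∑ j, theta j - algebraMap ℂ (Weyl m) a) * x i =
        x i * (∑ j, theta j - algebraMap ℂ (Weyl m) a) + x i := by
      rw [sub_mul, sum_theta_mul_x, mul_sub, (hconst a (x i)).eq]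
      abel
    have hth : Commute (∑ j, theta j - algebraMap ℂ (Weyl m) a)
        (theta i * (-theta i + algebraMap ℂ (Weyl m) (c i - 1))) :=
      (hEth i).mul_right ((hEth i).neg_right.add_right (hconst _ _))
    rw [mul_assoc (x i), ← mul_assoc, hx, add_mul, mul_assoc, hth.eq, mul_assoc (x i)]
  rw [pA_eq, pA_eq]
  refine commutator_identity ?_ ?_ ?_ ?_ ?_ ?_ (hEA i) (hEA j)
  · have hxx : Commute (x i * theta i * (-theta i + algebraMap ℂ (Weyl m) (c i - 1))) (x j) :=
      ((x_comm i j).mul_left (theta_x_commute h)).mul_left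
        ((theta_x_commute h).neg_left.add_left (Algebra.commutes _ _))
    exact (hxx.mul_right (hthX h)).mul_right ((hthX h).neg_right.add_right (hconst _ _))
  · exact (hthX h).sub_right (hconst _ _)
  · exact ((hthX h.symm).sub_right (hconst _ _)).symm
  · exact ((theta_comm i j).sub_right (hconst _ _)).sub_left (Algebra.commutes _ _)
  · exact (hEth i).sub_right (hconst _ _)
  · exact (hEth j).sub_right (hconst _ _)

/-! ### Leading terms of `p_i^A` -/

theorem xExp_inl (i : Fin m) : xExp (Finsupp.single (Sum.inl i) 1) = Finsupp.single i 1 := by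
  ext j
  change Finsupp.single (Sum.inl i : Vars m) 1 (Sum.inl j) = _
  classical
  simp [Finsupp.single_apply]

theorem xiExp_inl (i : Fin m) : xiExp (Finsupp.single (Sum.inl i) 1) = 0 := by
  ext j
  change Finsupp.single (Sum.inl i : Vars m) 1 (Sum.inr j) = _
  simp

theorem xExp_inr (i : Fin m) : xExp (Finsupp.single (Sum.inr i) 1) = 0 := by
  ext j
  change Finsupp.single (Sum.inr i : Vars m) 1 (Sum.inl j) = _
  simp

theorem xiExp_inr (i : Fin m) : xiExp (Finsupp.single (Sum.inr i) 1) = Finsupp.single i 1 := by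
  ext j
  change Finsupp.single (Sum.inr i : Vars m) 1 (Sum.inr j) = _
  classical
  simp [Finsupp.single_apply]

theorem x_eq_normalMonomial (i : Fin m) : x i = normalMonomial (Finsupp.single (Sum.inl i) 1) := by
  rw [normalMonomial, xExp_inl, xiExp_inl, dPow_zero, mul_one, xPow_single]

theorem d_eq_normalMonomial (i : Fin m) : d i = normalMonomial (Finsupp.single (Sum.inr i) 1) := by
  rw [normalMonomial, xExp_inr, xiExp_inr, xPow_zero, one_mul, dPow_single]

/-- The exponent of `x_i ξ_i`. -/
def thetaExp (i : Fin m) : Vars m →₀ ℕ :=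
  Finsupp.single (Sum.inl i) 1 + Finsupp.single (Sum.inr i) 1

/-- The exponent of `x_i^3 ξ_i^2`. -/
def leadExp (i : Fin m) : Vars m →₀ ℕ :=
  Finsupp.single (Sum.inl i) 1 + thetaExp i + thetaExp i

theorem degree_xiExp_thetaExp (i : Fin m) : (xiExp (thetaExp i)).degree = 1 := by
  rw [thetaExp, xiExp_add, xiExp_inl, xiExp_inr, zero_add, Finsupp.degree_single]

theorem degree_xiExp_leadExp (i : Fin m) : (xiExp (leadExp i)).degree = 2 := by
  rw [leadExp, xiExp_add, xiExp_add, xiExp_inl, map_add, zero_add, degree_xiExp_thetaExp]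

theorem leadExp_coprime {i j : Fin m} (h : i ≠ j) (k : Vars m) :
    leadExp i k = 0 ∨ leadExp j k = 0 := by
  classical
  rcases k with k | k <;> rcases eq_or_ne i k with rfl | hk <;>
    simp [leadExp, thetaExp, Finsupp.single_apply, *, Ne.symm]

theorem x_mem_orderLT (i : Fin m) : x i ∈ orderLT m 1 := by
  rw [x_eq_normalMonomial]
  exact normalMonomial_mem_termsIn (by simp [xiExp_inl])

theorem algebraMap_mem_orderLT (z : ℂ) : algebraMap ℂ (Weyl m) z ∈ orderLT m 1 := by
  rw [Algebra.algebraMap_eq_smul_one, ← mul_one (1 : Weyl m)]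
  nth_rw 1 [← xPow_zero]
  rw [← dPow_zero]
  exact Submodule.smul_mem _ _ (xPow_mul_dPow_mem_orderLT _ _ (by simp))

theorem algebraMap_mem_orderLT_two (z : ℂ) : algebraMap ℂ (Weyl m) z ∈ orderLT m 2 :=
  orderLT_mono one_le_two (algebraMap_mem_orderLT z)

theorem theta_mem_orderLT (i : Fin m) : theta i ∈ orderLT m 2 := by
  rw [theta, euler, ← xPow_single, ← dPow_single]
  exact xPow_mul_dPow_mem_orderLT _ _ (by simp)

theorem sum_theta_mem_orderLT : ∑ j, theta j ∈ orderLT m 2 :=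
  Submodule.sum_mem _ fun j _ => theta_mem_orderLT j

variable {t : MonomialOrder (Vars m)}

theorem leadsWith_theta (i : Fin m) : LeadsWith t (theta i) (thetaExp i) 1 := by
  have hx := leadsWith_normalMonomial (t := t) (Finsupp.single (Sum.inl i) 1)
  have hd := leadsWith_normalMonomial (t := t) (Finsupp.single (Sum.inr i) 1)
  rw [← x_eq_normalMonomial] at hx
  rw [← d_eq_normalMonomial] at hd
  rw [← one_mul (1 : ℂ)]
  exact hx.mul hd

theorem algebraMap_mem_below_thetaExp (z : ℂ) (i : Fin m) :
    algebraMap ℂ (Weyl m) z ∈ below t (thetaExp i) :=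
  orderLT_le_below _ (by rw [degree_xiExp_thetaExp]; exact algebraMap_mem_orderLT z)

/-- Both sides have order 1, so the X-degrees 1 < 2 decide and the tie-breaker plays no role. -/
theorem thetaExp_lt (i j : Fin m) :
    thetaExp j ≺[zeroOneOrder t] Finsupp.single (Sum.inl i) 1 + thetaExp i := by
  rw [zeroOneOrder_lt_iff]
  right; left
  simp [thetaExp, Finset.sum_add_distrib, Finsupp.single_apply]

theorem sum_theta_mul_theta_mem_below (z w : ℂ) (i : Fin m) :
    (∑ j, theta j - algebraMap ℂ (Weyl m) z) * (theta i - algebraMap ℂ (Weyl m) w) ∈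
      below t (leadExp i) :=
  below_mul_upTo
    (sub_mem (Submodule.sum_mem _ fun j _ =>
        upTo_le_below (thetaExp_lt i j) (leadsWith_theta j).mem_upTo)
      (below_mono (thetaExp_lt i i).le (algebraMap_mem_below_thetaExp z i)))
    (sub_mem (leadsWith_theta i).mem_upTo (below_le_upTo _ (algebraMap_mem_below_thetaExp w i)))

theorem leadsWith_pA (i : Fin m) : LeadsWith t (pA x d a b c i) (leadExp i) (-1) := by
  have hx := leadsWith_normalMonomial (t := t) (Finsupp.single (Sum.inl i) 1)
  rw [← x_eq_normalMonomial] at hx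
  have h := (hx.mul (leadsWith_theta i)).mul
    ((leadsWith_theta i).neg.add_of_mem_below (algebraMap_mem_below_thetaExp (c i - 1) i))
  rw [one_mul, one_mul] at h
  rw [pA_eq]
  exact LeadsWith.add_of_mem_below h (sum_theta_mul_theta_mem_below a (b i) i)

theorem exists_leadsWith_of_mem_span_pA (Q : Fin m → Weyl m)
    (hQ : ∑ i, Q i * pA x d a b c i ≠ 0) :
    ∃ i s z, leadExp i ≤ s ∧ z ≠ 0 ∧ LeadsWith t (∑ i, Q i * pA x d a b c i) s z := by
  have hB : ∀ i, theta i - algebraMap ℂ (Weyl m) (b i) ∈ below t (leadExp i) := fun i =>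
    orderLT_le_below _ (by
      rw [degree_xiExp_leadExp]
      exact sub_mem (theta_mem_orderLT i) (algebraMap_mem_orderLT_two _))
  refine exists_leadsWith_of_mem_span (r := fun _ => -1) (by simp) (leadsWith_pA a b c)
    (fun i j h => leadExp_coprime h) (fun i j h => ?_) Q hQ
  -- Here C = p_i - (θ_i - b_i) and C' = θ_j - b_j; each θ_k - b_k has order at most 1, hence lies
  -- below the order-2 leading exponents.
  exact ⟨_, sub_mem (leadsWith_pA a b c i).mem_upTo (below_le_upTo _ (hB i)), _, hB j,
    pA_mul_pA a b c h.ne'⟩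

theorem pA_sub_ellB_mem_orderLT (a' b' : Fin m → ℂ) (c' : ℂ) (i : Fin m) :
    pA x d a b c i - ellB x d a' b' c' i ∈ orderLT m 2 := by
  -- The quadratic parts cancel once (∑ θ_j) θ_i is rewritten as θ_i ∑ θ_j; each remaining product
  -- contains at most one factor of order 1.
  have e : pA x d a b c i - ellB x d a' b' c' i =
      x i * theta i * (algebraMap ℂ (Weyl m) (c i - 1) + algebraMap ℂ (Weyl m) (b' i)) +
        x i * algebraMap ℂ (Weyl m) (a' i) * (theta i + algebraMap ℂ (Weyl m) (b' i)) -
        (∑ j, theta j) * algebraMap ℂ (Weyl m) (b i) -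
        algebraMap ℂ (Weyl m) a * (theta i - algebraMap ℂ (Weyl m) (b i)) -
        theta i * algebraMap ℂ (Weyl m) (c' - 1) := by
    have h := (sum_theta_comm i).eq
    have hB : ellB x d a' b' c' i = theta i * (∑ j, theta j + algebraMap ℂ (Weyl m) (c' - 1)) -
      x i * (theta i + algebraMap ℂ (Weyl m) (a' i)) *
        (theta i + algebraMap ℂ (Weyl m) (b' i)) := rfl
    rw [pA_eq, hB, sub_mul (∑ j, theta j), mul_sub (∑ j, theta j), h]
    noncomm_ring
  have hth := theta_mem_orderLT i
  have hk := fun z => algebraMap_mem_orderLT (m := m) z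
  have hx := x_mem_orderLT i
  rw [e]
  refine sub_mem (sub_mem (sub_mem (add_mem ?_ ?_) ?_) ?_) ?_
  · exact mul_mem_orderLT (k := 1) (n := 0) (mul_mem_orderLT (k := 0) (n := 1) hx hth)
      (add_mem (hk _) (hk _))
  · exact mul_mem_orderLT (k := 0) (n := 1) (mul_mem_orderLT (k := 0) (n := 0) hx (hk _))
      (add_mem hth (algebraMap_mem_orderLT_two _))
  · exact mul_mem_orderLT (k := 1) (n := 0) sum_theta_mem_orderLT (hk _)
  · exact mul_mem_orderLT (k := 0) (n := 1) (hk _)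
      (sub_mem hth (algebraMap_mem_orderLT_two _))
  · exact mul_mem_orderLT (k := 1) (n := 0) hth (hk _)

theorem pA_mem_orderLT (i : Fin m) : pA x d a b c i ∈ orderLT m 3 := by
  have hth := theta_mem_orderLT i
  have hk := fun z => algebraMap_mem_orderLT_two (m := m) z
  rw [pA_eq]
  refine add_mem ?_ ?_
  · exact mul_mem_orderLT (k := 1) (n := 1)
      (mul_mem_orderLT (k := 0) (n := 1) (x_mem_orderLT i) hth) (add_mem (neg_mem hth) (hk _))
  · exact mul_mem_orderLT (k := 1) (n := 1) (sub_mem sum_theta_mem_orderLT (hk _))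
      (sub_mem hth (hk _))

end Operators

end Weyl

end Lauricella

end

noncomputable section

namespace Lauricella

/-! ### Initial forms -/

/-- A difference of weight below n cannot affect coefficients of weight n or more, so g also attains
top weight n, with the same component. -/
theorem weightedHomogeneousComponent_weightedTotalDegree_eq {σ R : Type*} [CommRing R]
    {w : σ → ℕ} {f g : MvPolynomial σ R} {n : ℕ}
    (hle : ∀ s, f.coeff s ≠ 0 → Finsupp.weight w s ≤ n)
    (hex : ∃ s, f.coeff s ≠ 0 ∧ Finsupp.weight w s = n)
    (hfg : ∀ s, (f - g).coeff s ≠ 0 → Finsupp.weight w s < n) :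
    MvPolynomial.weightedHomogeneousComponent w (MvPolynomial.weightedTotalDegree w f) f =
      MvPolynomial.weightedHomogeneousComponent w (MvPolynomial.weightedTotalDegree w g) g := by
  have hcoeff : ∀ s, n ≤ Finsupp.weight w s → f.coeff s = g.coeff s := by
    intro s hs
    by_contra h
    exact absurd (hfg s (by rwa [MvPolynomial.coeff_sub, sub_ne_zero])) (not_lt.mpr hs)
  have hdeg : ∀ h : MvPolynomial σ R, (∀ s, h.coeff s ≠ 0 → Finsupp.weight w s ≤ n) →
      (∃ s, h.coeff s ≠ 0 ∧ Finsupp.weight w s = n) →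
      MvPolynomial.weightedTotalDegree w h = n := by
    rintro h hh ⟨s, hs, hsn⟩
    refine le_antisymm (Finset.sup_le fun s hs => hh s (MvPolynomial.mem_support_iff.mp hs)) ?_
    rw [← hsn]
    exact MvPolynomial.le_weightedTotalDegree w (MvPolynomial.mem_support_iff.mpr hs)
  rw [hdeg f hle hex, hdeg g]
  · ext s
    simp only [MvPolynomial.coeff_weightedHomogeneousComponent]
    split_ifs with hs
    · exact hcoeff s hs.ge
    · rfl
  · intro s hs
    by_contra hn
    refine hs ?_
    rw [← hcoeff s (by omega)]
    by_contra h
    exact hn (hle s h)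
  · obtain ⟨s, hs, hsn⟩ := hex
    exact ⟨s, by rwa [← hcoeff s hsn.ge], hsn⟩

theorem weight_eq_degree_xiExp {m : ℕ} (s : Vars m →₀ ℕ) :
    Finsupp.weight (Sum.elim (fun _ => 0) (fun _ => 1) : Vars m → ℕ) s = (xiExp s).degree := by
  rw [Finsupp.weight_apply, Finsupp.sum_fintype _ _ (by simp), Fintype.sum_sum_type,
    Finsupp.degree_eq_sum]
  simp only [Sum.elim_inl, Sum.elim_inr, smul_eq_mul, mul_zero, mul_one, Finset.sum_const_zero,
    zero_add]
  rfl

/-- Initial forms involve no tie-breaker, but one is chosen to read off a nonzero order-2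
coefficient of p_i from its leading term. -/
theorem nonempty_monomialOrder.{u} (σ : Type u) [Finite σ] : Nonempty (MonomialOrder.{u, u} σ) := by
  let : LinearOrder σ := LinearOrder.lift' (Finite.equivFin σ) (Equiv.injective _)
  exact ⟨MonomialOrder.lex⟩

theorem initialForm_pA_eq {m : ℕ} (a : ℂ) (b c a' b' : Fin m → ℂ) (c' : ℂ) (i : Fin m) :
    initialForm (pA (A := WeylAlgebra m) x d a b c i) = initialForm (ellB x d a' b' c' i) := by
  refine weightedHomogeneousComponent_weightedTotalDegree_eq (n := 2) ?_ ?_ ?_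
  · intro s hs
    rw [weight_eq_degree_xiExp]
    exact Nat.lt_succ_iff.mp (Weyl.mem_termsIn_iff.mp (Weyl.pA_mem_orderLT a b c i) s hs)
  · refine ⟨Weyl.leadExp i, ?_, ?_⟩
    · obtain ⟨t⟩ := nonempty_monomialOrder (Vars m)
      have h := (Weyl.leadsWith_pA (t := t) a b c i).coeff_symbol
      exact fun h0 => neg_ne_zero.mpr (one_ne_zero (α := ℂ)) (h.symm.trans h0)
    · rw [weight_eq_degree_xiExp, Weyl.degree_xiExp_leadExp]
  · intro s hs
    rw [weight_eq_degree_xiExp]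
    refine Weyl.mem_termsIn_iff.mp (Weyl.pA_sub_ellB_mem_orderLT a b c a' b' c' i) s ?_
    rw [map_sub]
    exact hs

/-! ### The Gröbner basis -/

theorem isGroebnerBasis_pA {m : ℕ} (a : ℂ) (b c : Fin m → ℂ) (t : MonomialOrder (Vars m)) :
    IsGroebnerBasis (zeroOneOrder t) (Set.range (pA (A := WeylAlgebra m) x d a b c))
      (Ideal.span (Set.range (pA (A := WeylAlgebra m) x d a b c))) := by
  have hinit : ∀ (P : Weyl m) (s : Vars m →₀ ℕ) (z : ℂ), z ≠ 0 → Weyl.LeadsWith t P s z →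
      initialTerm (zeroOneOrder t) (P : WeylAlgebra m) = MvPolynomial.monomial s z :=
    fun P s z hz h => h.leadingTerm_eq hz
  refine ⟨Set.finite_range _, rfl, le_antisymm
    (Ideal.span_mono (Set.image_mono Ideal.subset_span)) (Ideal.span_le.mpr ?_)⟩
  rintro _ ⟨P, hP, rfl⟩
  obtain ⟨Q, hQ⟩ := (Submodule.mem_span_range_iff_exists_fun _).mp hP
  obtain ⟨Q, rfl⟩ : ∃ Q : Fin m → Weyl m, (∑ i, Q i * pA Weyl.x Weyl.d a b c i : Weyl m) = P :=
    ⟨Q, hQ⟩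
  rw [SetLike.mem_coe]
  by_cases h0 : (∑ i, Q i * pA Weyl.x Weyl.d a b c i : Weyl m) = 0
  · have : initialTerm (zeroOneOrder t)
        ((∑ i, Q i * pA Weyl.x Weyl.d a b c i : Weyl m) : WeylAlgebra m) = 0 := by
      rw [h0]
      exact (MonomialOrder.leadingTerm_eq_zero_iff _).mpr (map_zero (Weyl.symbol m))
    exact this ▸ zero_mem _
  · obtain ⟨i, s, z, his, hz, hlead⟩ := Weyl.exists_leadsWith_of_mem_span_pA (t := t) a b c Q h0
    obtain ⟨v, rfl⟩ := exists_add_of_le his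
    -- The factor -z compensates the leading coefficient -1 of p_i.
    have e : MvPolynomial.monomial (Weyl.leadExp i + v) z =
        MvPolynomial.monomial v (-z) * MvPolynomial.monomial (Weyl.leadExp i) (-1 : ℂ) := by
      rw [MvPolynomial.monomial_mul, add_comm, neg_mul_neg, mul_one]
    rw [hinit _ _ _ hz hlead, e]
    refine Ideal.mul_mem_left _ _ (Ideal.subset_span ⟨_, ⟨i, rfl⟩, ?_⟩)
    exact hinit _ _ _ (neg_ne_zero.mpr one_ne_zero) (Weyl.leadsWith_pA a b c i)

/-! ### The change of coordinates -/

section Torus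

variable {m : ℕ}

theorem laurentX_single (i : Fin m) (n : Fin m → ℤ) (z : ℂ) :
    laurentX i (AddMonoidAlgebra.single n z) = AddMonoidAlgebra.single (n + Pi.single i 1) z := by
  rw [laurentX, LinearMap.mulLeft_apply, AddMonoidAlgebra.single_mul_single, one_mul, add_comm]

theorem euler_laurent_single (i : Fin m) (n : Fin m → ℤ) (z : ℂ) :
    euler laurentX laurentD i (AddMonoidAlgebra.single n z) =
      AddMonoidAlgebra.single n (n i * z) := by
  have h : (AddMonoidAlgebra.single n z : Laurent m) =
      z • AddMonoidAlgebra.basis (Fin m → ℤ) ℂ n := by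
    rw [AddMonoidAlgebra.basis_apply, AddMonoidAlgebra.smul_single, smul_eq_mul, mul_one]
  have hD : laurentD i (AddMonoidAlgebra.single n z : Laurent m) =
      z • AddMonoidAlgebra.single (n - Pi.single i 1) (n i : ℂ) := by
    rw [h, map_smul, laurentD, Module.Basis.constr_basis]
  rw [euler, Module.End.mul_apply, hD, map_smul, laurentX_single, sub_add_cancel,
    AddMonoidAlgebra.smul_single, smul_eq_mul, mul_comm]

theorem sum_euler_laurent_single (n : Fin m → ℤ) (z : ℂ) :
    (∑ j, euler laurentX laurentD j) (AddMonoidAlgebra.single n z : Laurent m) =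
      AddMonoidAlgebra.single n ((∑ j, (n j : ℂ)) * z) := by
  simp only [LinearMap.sum_apply, euler_laurent_single, Finset.sum_mul]
  exact (map_sum (AddMonoidAlgebra.singleAddHom n) _ _).symm

theorem laurentInv_single (n : Fin m → ℤ) (z : ℂ) :
    laurentInv m (AddMonoidAlgebra.single n z) = AddMonoidAlgebra.single (-n) z := by
  rw [laurentInv, AddMonoidAlgebra.domCongr_single]
  rfl

theorem laurentInv_symm_single (n : Fin m → ℤ) (z : ℂ) :
    (laurentInv m).symm (AddMonoidAlgebra.single n z) = AddMonoidAlgebra.single (-n) z := by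
  rw [AlgEquiv.symm_apply_eq, laurentInv_single, neg_neg]

theorem ellA_laurent_single (a : ℂ) (b c : Fin m → ℂ) (i : Fin m) (n : Fin m → ℤ) (z : ℂ) :
    ellA laurentX laurentD a b c i (AddMonoidAlgebra.single n z) =
      AddMonoidAlgebra.single n (n i * (n i + (c i - 1)) * z) -
        AddMonoidAlgebra.single (n + Pi.single i 1) ((∑ j, (n j : ℂ) + a) * (n i + b i) * z) := by
  simp only [ellA, LinearMap.sub_apply, Module.End.mul_apply, LinearMap.add_apply,
    euler_laurent_single, sum_euler_laurent_single, Module.algebraMap_end_apply,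
    AddMonoidAlgebra.smul_single, ← AddMonoidAlgebra.single_add, laurentX_single, smul_eq_mul]
  congr 2 <;> ring

theorem pA_laurent_single (a : ℂ) (b c : Fin m → ℂ) (i : Fin m) (n : Fin m → ℤ) (z : ℂ) :
    pA laurentX laurentD a b c i (AddMonoidAlgebra.single n z) =
      AddMonoidAlgebra.single (n + Pi.single i 1) (n i * (-n i + (c i - 1)) * z) +
        AddMonoidAlgebra.single n ((∑ j, (n j : ℂ) - a) * (n i - b i) * z) := by
  simp only [pA, LinearMap.sub_apply, Module.End.mul_apply, LinearMap.add_apply,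
    LinearMap.neg_apply, euler_laurent_single, sum_euler_laurent_single,
    Module.algebraMap_end_apply, AddMonoidAlgebra.smul_single, ← AddMonoidAlgebra.single_add,
    ← AddMonoidAlgebra.single_sub, ← AddMonoidAlgebra.single_neg, laurentX_single, smul_eq_mul]
  congr 2 <;> ring

theorem pA_eq_invertCoordinates (a : ℂ) (b c : Fin m → ℂ) (i : Fin m) :
    pA laurentX laurentD a b c i =
      -(laurentX i * invertCoordinates (ellA laurentX laurentD a b c i)) := by
  -- On X^n both sides are combinations of X^n and X^{n + e_i}; inversion evaluates ℓ_i^A at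
  -- exponent -n, which accounts for the signs.
  refine (AddMonoidAlgebra.basis (Fin m → ℤ) ℂ).ext fun n => ?_
  have hinv : invertCoordinates (ellA laurentX laurentD a b c i)
      (AddMonoidAlgebra.single n 1 : Laurent m) =
      laurentInv m (ellA laurentX laurentD a b c i
        ((laurentInv m).symm (AddMonoidAlgebra.single n 1))) := rfl
  rw [AddMonoidAlgebra.basis_apply, LinearMap.neg_apply, Module.End.mul_apply, hinv,
    laurentInv_symm_single, ellA_laurent_single, pA_laurent_single, map_sub, map_sub,
    laurentInv_single, laurentInv_single, laurentX_single, laurentX_single, neg_sub]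
  -- The factor x_i in ℓ_i^A becomes X_i^{-1} and cancels the X_i multiplied on the left.
  have h1 : -(-n + Pi.single i (1 : ℤ)) + Pi.single i 1 = n := by abel
  rw [h1, neg_neg, add_comm, sub_eq_add_neg (AddMonoidAlgebra.single n _), ← AddMonoidAlgebra.single_neg]
  simp only [Pi.neg_apply, Int.cast_neg, Finset.sum_neg_distrib]
  congr 2 <;> ring

end Torus

end Lauricella

end

/-! ### The three statements together -/

theorem mainTheorem8 (m : ℕ) (a : ℂ) (b c : Fin m → ℂ) :
    (∀ i : Fin m,
      Lauricella.pA Lauricella.laurentX Lauricella.laurentD a b c i =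
        -(Lauricella.laurentX i * Lauricella.invertCoordinates
          (Lauricella.ellA Lauricella.laurentX Lauricella.laurentD a b c i))) ∧
    (∀ t : MonomialOrder (Fin m ⊕ Fin m),
      Lauricella.IsGroebnerBasis (Lauricella.zeroOneOrder t)
        (Set.range (Lauricella.pA (A := Lauricella.WeylAlgebra m)
          Lauricella.x Lauricella.d a b c))
        (Ideal.span (Set.range (Lauricella.pA (A := Lauricella.WeylAlgebra m)
          Lauricella.x Lauricella.d a b c)))) ∧
    (∀ (a' b' : Fin m → ℂ) (c' : ℂ) (i : Fin m),
      Lauricella.initialForm (Lauricella.pA Lauricella.x Lauricella.d a b c i) =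
        Lauricella.initialForm (Lauricella.ellB Lauricella.x Lauricella.d a' b' c' i)) := by
  exact ⟨Lauricella.pA_eq_invertCoordinates a b c, Lauricella.isGroebnerBasis_pA a b c,
    fun a' b' c' i => Lauricella.initialForm_pA_eq a b c a' b' c' i⟩
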